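/- Let $k$ be an algebraically closed field of characteristic $0$. Let $f(X,Z)=\sum_{i=0}^6 a_iX^iZ^{6-i}$ be a binary sextic over $k$ without multiple linear factors, and let $\mathcal C$ be the genus $2$ curve $Y^2=f(X,1)$, with function field $K=k(X)[Y]/(Y^2-f(X,1))$. Write $\mathrm{Aut}(\mathcal C)=\mathrm{Aut}(K/k)$; two curves are called isomorphic if their function fields are isomorphic over $k$. Let $J_2,J_4,J_6$ be the classical (Igusa–Clebsch) invariants of $f$, normalized so that $J_2=-240a_0a_6+40a_1a_5-16a_2a_4+6a_3^2$ and, in terms of the roots $x_1,\dots,x_6$ of $f(X,1)$ when $a_6\neq 0$, with $(ij)=x_i-x_j$, $$J_4=a_6^4\sum_{10}(12)^2(23)^2(31)^2(45)^2(56)^2(64)^2,\qquad J_6=a_6^6\sum_{60}(12)^2(23)^2(31)^2(45)^2(56)^2(64)^2(14)^2(25)^2(36)^2$$ (sums over the distinct terms obtained by permuting the roots; these are polynomials in the $a_i$, which define $J_4,J_6$ also for $a_6=0$). Assume $J_2\neq 0$ and put $$i_1=144\frac{J_4}{J_2^2},\qquad i_2=-1728\,\frac{J_2J_4-3J_6}{J_2^3}.$$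 i) If $\mathrm{Aut}(\mathcal C)$ is isomorphic to the dihedral group $D_8$ of order $8$, then $2925i_1^2+250i_1i_2-9450i_2-54000i_1+139968\neq 0$ and $\mathcal C$ is isomorphic to the genus $2$ curve $Y^2=X^5+X^3+tX$ with $$t=-\frac34\cdot\frac{345i_1^2+50i_1i_2-90i_2-1296i_1}{2925i_1^2+250i_1i_2-9450i_2-54000i_1+139968}.$$ Moreover this is the only $t\in k$ for which $Y^2=X^5+X^3+tX$ is a genus $2$ curve isomorphic to $\mathcal C$. ii) If $\mathrm{Aut}(\mathcal C)$ is isomorphic to the dihedral group $D_{12}$ of order $12$, then $2700i_1^2+1000i_1i_2+204525i_1+40950i_2-708588\neq 0$ and $\mathcal C$ is isomorphic to the genus $2$ curve $Y^2=X^6+X^3+t$ with $$t=\frac14\cdot\frac{540i_1^2+100i_1i_2-1782i_1+45i_2}{2700i_1^2+1000i_1i_2+204525i_1+40950i_2-708588}.$$ Moreover this is the only $t\in k$ for which $Y^2=X^6+X^3+t$ is a genus $2$ curve isomorphic to $\mathcal C$. In both cases, if $i_1,i_2\in\mathbb Q$, then $\mathcal C$ has a model over $\mathbb Q$: there is $g\in\mathbb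 Q[X]$, squarefree of degree $5$ or $6$, such that $\mathcal C$ is isomorphic to the curve $Y^2=g(X)$ over $k$. -/

import Mathlib

open Polynomial

noncomputable section

namespace GenusTwo

/-- A binary sextic `∑ aᵢ Xⁱ Z⁶⁻ⁱ` is recorded by its dehomogenization `f = ∑ aᵢ Xⁱ`. It has no
multiple linear factor (equivalently, its discriminant `J₁₀` as a binary sextic is nonzero) exactly
when `f` is squarefree of degree `6`, or of degree `5` (then `Z` is a simple factor). These are the
sextics for which `Y² = f(X)` is a curve of genus two. -/
def IsGenusTwoSextic {k : Type*} [Field k] (f : k[X]) : Prop :=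
  (f.natDegree = 5 ∨ f.natDegree = 6) ∧ Squarefree f

/-- The function field `k(X)[Y] / (Y² - f(X))` of the curve `Y² = f(X)`. -/
abbrev CurveField {k : Type*} [Field k] (f : k[X]) : Type _ :=
  AdjoinRoot (X ^ 2 - C (algebraMap k[X] (RatFunc k) f) : (RatFunc k)[X])

/-- The curves `Y² = f(X)` and `Y² = g(X)` are isomorphic over `k`:
their function fields are isomorphic over `k`. -/
def CurveIso {k : Type*} [Field k] (f g : k[X]) : Prop :=
  Nonempty (CurveField f ≃ₐ[k] CurveField g)

/-- The group of automorphisms of the function field of `Y² = f(X)` over `k`. -/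
abbrev CurveAut {k : Type*} [Field k] (f : k[X]) : Type _ :=
  CurveField f ≃ₐ[k] CurveField f

/-- The classical (Igusa–Clebsch) invariant of degree `2` of the binary sextic `∑ aᵢ Xⁱ Z⁶⁻ⁱ`. -/
def J2 {k : Type*} [Field k] (f : k[X]) : k :=
  let a := f.coeff
  40 * a 1 * a 5 - 240 * a 0 * a 6 - 16 * a 2 * a 4 + 6 * a 3 ^ 2

/-- The classical (Igusa–Clebsch) invariant of degree `4` of the binary sextic `∑ aᵢ Xⁱ Z⁶⁻ⁱ`. -/
def J4 {k : Type*} [Field k] (f : k[X]) : k :=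
  let a := f.coeff
  1620 * a 0 ^ 2 * a 6 ^ 2 - 540 * a 0 * a 1 * a 5 * a 6 - 504 * a 0 * a 2 * a 4 * a 6 +
  300 * a 0 * a 2 * a 5 ^ 2 + 324 * a 0 * a 3 ^ 2 * a 6 - 180 * a 0 * a 3 * a 4 * a 5 +
  48 * a 0 * a 4 ^ 3 + 300 * a 1 ^ 2 * a 4 * a 6 - 80 * a 1 ^ 2 * a 5 ^ 2 -
  180 * a 1 * a 2 * a 3 * a 6 + 4 * a 1 * a 2 * a 4 * a 5 + 36 * a 1 * a 3 ^ 2 * a 5 -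
  12 * a 1 * a 3 * a 4 ^ 2 + 48 * a 2 ^ 3 * a 6 - 12 * a 2 ^ 2 * a 3 * a 5 +
  4 * a 2 ^ 2 * a 4 ^ 2

/-- The classical (Igusa–Clebsch) invariant of degree `6` of the binary sextic `∑ aᵢ Xⁱ Z⁶⁻ⁱ`. -/
def J6 {k : Type*} [Field k] (f : k[X]) : k :=
  let a := f.coeff
  59940 * a 0 ^ 2 * a 1 * a 5 * a 6 ^ 2 - 119880 * a 0 ^ 3 * a 6 ^ 3 +
  20664 * a 0 ^ 2 * a 2 * a 4 * a 6 ^ 2 - 18600 * a 0 ^ 2 * a 2 * a 5 ^ 2 * a 6 -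
  10044 * a 0 ^ 2 * a 3 ^ 2 * a 6 ^ 2 + 3060 * a 0 ^ 2 * a 3 * a 4 * a 5 * a 6 +
  2250 * a 0 ^ 2 * a 3 * a 5 ^ 3 - 96 * a 0 ^ 2 * a 4 ^ 3 * a 6 -
  900 * a 0 ^ 2 * a 4 ^ 2 * a 5 ^ 2 - 18600 * a 0 * a 1 ^ 2 * a 4 * a 6 ^ 2 -
  2240 * a 0 * a 1 ^ 2 * a 5 ^ 2 * a 6 + 3060 * a 0 * a 1 * a 2 * a 3 * a 6 ^ 2 +
  3472 * a 0 * a 1 * a 2 * a 4 * a 5 * a 6 + 1600 * a 0 * a 1 * a 2 * a 5 ^ 3 +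
  1818 * a 0 * a 1 * a 3 ^ 2 * a 5 * a 6 - 876 * a 0 * a 1 * a 3 * a 4 ^ 2 * a 6 -
  1860 * a 0 * a 1 * a 3 * a 4 * a 5 ^ 2 + 616 * a 0 * a 1 * a 4 ^ 3 * a 5 -
  96 * a 0 * a 2 ^ 3 * a 6 ^ 2 - 876 * a 0 * a 2 ^ 2 * a 3 * a 5 * a 6 +
  424 * a 0 * a 2 ^ 2 * a 4 ^ 2 * a 6 - 640 * a 0 * a 2 ^ 2 * a 4 * a 5 ^ 2 -
  468 * a 0 * a 2 * a 3 ^ 2 * a 4 * a 6 + 330 * a 0 * a 2 * a 3 ^ 2 * a 5 ^ 2 +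
  492 * a 0 * a 2 * a 3 * a 4 ^ 2 * a 5 - 160 * a 0 * a 2 * a 4 ^ 4 +
  162 * a 0 * a 3 ^ 4 * a 6 - 198 * a 0 * a 3 ^ 3 * a 4 * a 5 +
  60 * a 0 * a 3 ^ 2 * a 4 ^ 3 + 2250 * a 1 ^ 3 * a 3 * a 6 ^ 2 +
  1600 * a 1 ^ 3 * a 4 * a 5 * a 6 - 320 * a 1 ^ 3 * a 5 ^ 3 -
  900 * a 1 ^ 2 * a 2 ^ 2 * a 6 ^ 2 - 1860 * a 1 ^ 2 * a 2 * a 3 * a 5 * a 6 -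
  640 * a 1 ^ 2 * a 2 * a 4 ^ 2 * a 6 + 64 * a 1 ^ 2 * a 2 * a 4 * a 5 ^ 2 +
  330 * a 1 ^ 2 * a 3 ^ 2 * a 4 * a 6 + 176 * a 1 ^ 2 * a 3 ^ 2 * a 5 ^ 2 +
  26 * a 1 ^ 2 * a 3 * a 4 ^ 2 * a 5 - 36 * a 1 ^ 2 * a 4 ^ 4 +
  616 * a 1 * a 2 ^ 3 * a 5 * a 6 + 492 * a 1 * a 2 ^ 2 * a 3 * a 4 * a 6 +
  26 * a 1 * a 2 ^ 2 * a 3 * a 5 ^ 2 + 28 * a 1 * a 2 ^ 2 * a 4 ^ 2 * a 5 -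
  198 * a 1 * a 2 * a 3 ^ 3 * a 6 - 238 * a 1 * a 2 * a 3 ^ 2 * a 4 * a 5 +
  76 * a 1 * a 2 * a 3 * a 4 ^ 3 + 72 * a 1 * a 3 ^ 4 * a 5 - 24 * a 1 * a 3 ^ 3 * a 4 ^ 2 -
  160 * a 2 ^ 4 * a 4 * a 6 - 36 * a 2 ^ 4 * a 5 ^ 2 + 60 * a 2 ^ 3 * a 3 ^ 2 * a 6 +
  76 * a 2 ^ 3 * a 3 * a 4 * a 5 - 24 * a 2 ^ 3 * a 4 ^ 3 - 24 * a 2 ^ 2 * a 3 ^ 3 * a 5 +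
  8 * a 2 ^ 2 * a 3 ^ 2 * a 4 ^ 2

/-- The first absolute invariant (meaningful when `J2 f ≠ 0`). -/
def i1 {k : Type*} [Field k] (f : k[X]) : k :=
  144 * J4 f / J2 f ^ 2

/-- The second absolute invariant (meaningful when `J2 f ≠ 0`). -/
def i2 {k : Type*} [Field k] (f : k[X]) : k :=
  -1728 * (J2 f * J4 f - 3 * J6 f) / J2 f ^ 3

/-- The sextic `X⁵ + X³ + t X` of the normal form for automorphism group `D₈`. -/
def d8Form {k : Type*} [Field k] (t : k) : k[X] :=
  X ^ 5 + X ^ 3 + C t * X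

/-- The sextic `X⁶ + X³ + t` of the normal form for automorphism group `D₁₂`. -/
def d12Form {k : Type*} [Field k] (t : k) : k[X] :=
  X ^ 6 + X ^ 3 + C t

/-- The numerator of the parameter of the `D₈` normal form. -/
def d8Num {k : Type*} [Field k] (u v : k) : k :=
  345 * u ^ 2 + 50 * u * v - 90 * v - 1296 * u

/-- The denominator of the parameter of the `D₈` normal form. -/
def d8Den {k : Type*} [Field k] (u v : k) : k :=
  2925 * u ^ 2 + 250 * u * v - 9450 * v - 54000 * u + 139968

/-- The numerator of the parameter of the `D₁₂` normal form. -/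
def d12Num {k : Type*} [Field k] (u v : k) : k :=
  540 * u ^ 2 + 100 * u * v - 1782 * u + 45 * v

/-- The denominator of the parameter of the `D₁₂` normal form. -/
def d12Den {k : Type*} [Field k] (u v : k) : k :=
  2700 * u ^ 2 + 1000 * u * v + 204525 * u + 40950 * v - 708588

/-- The parameter of the `D₈` normal form as a rational function of `(i₁, i₂)`
(meaningful when `d8Den u v ≠ 0`). -/
def d8Param {k : Type*} [Field k] (u v : k) : k :=
  -(3 / 4) * (d8Num u v / d8Den u v)

/-- The parameter of the `D₁₂` normal form as a rational function of `(i₁, i₂)`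
(meaningful when `d12Den u v ≠ 0`). -/
def d12Param {k : Type*} [Field k] (u v : k) : k :=
  1 / 4 * (d12Num u v / d12Den u v)

/-- The curve `Y² = f(X)` over `k` has a model `Y² = g(X)` of genus two defined over `ℚ`. -/
def HasRationalModel {k : Type*} [Field k] [CharZero k] (f : k[X]) : Prop :=
  ∃ g : ℚ[X], IsGenusTwoSextic g ∧ CurveIso f (g.map (algebraMap ℚ k))

end GenusTwo

end

noncomputable section

namespace GenusTwo

/-! ### The function field of Y² = f(X) as a quadratic extension of k(X) -/

section FunctionField

variable {k : Type*} [Field k]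

theorem exists_polynomial_of_sq_mul_eq {g D : k[X]} (hg : Squarefree g) {r : RatFunc k}
    (h : r ^ 2 * algebraMap k[X] (RatFunc k) g = algebraMap k[X] (RatFunc k) D) :
    ∃ p : k[X], r = algebraMap k[X] (RatFunc k) p := by
  have hd : algebraMap k[X] (RatFunc k) r.denom ≠ 0 := by
    simpa using r.denom_ne_zero
  have hr : r = algebraMap k[X] (RatFunc k) r.num / algebraMap k[X] (RatFunc k) r.denom :=
    (RatFunc.num_div_denom r).symm
  have h1 : r.num ^ 2 * g = D * r.denom ^ 2 := by
    apply IsFractionRing.injective k[X] (RatFunc k)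
    simp only [map_mul, map_pow]
    rw [← h]
    nth_rewrite 2 [hr]
    field_simp
  -- The squared denominator is coprime to the squared numerator, so it must be absorbed by the
  -- squarefree g.
  have h2 : r.denom * r.denom ∣ g := by
    rw [← sq]
    have hc : IsCoprime (r.denom ^ 2) (r.num ^ 2) := (RatFunc.isCoprime_num_denom r).symm.pow
    exact hc.dvd_of_dvd_mul_left ⟨D, by rw [h1]; ring⟩
  have h3 : IsUnit r.denom := hg _ h2
  obtain ⟨c, hc⟩ := h3.exists_right_inv
  refine ⟨r.num * c, ?_⟩
  have hc' := congrArg (algebraMap k[X] (RatFunc k)) hc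
  rw [map_mul, map_one] at hc'
  nth_rewrite 1 [hr]
  rw [div_eq_iff hd, map_mul, mul_assoc, mul_comm (algebraMap k[X] (RatFunc k) c), hc', mul_one]

theorem IsGenusTwoSextic.ne_zero {f : k[X]} (hf : IsGenusTwoSextic f) : f ≠ 0 := hf.2.ne_zero

theorem IsGenusTwoSextic.five_le {f : k[X]} (hf : IsGenusTwoSextic f) : 5 ≤ f.natDegree := by
  rcases hf.1 with h | h <;> omega

theorem IsGenusTwoSextic.le_six {f : k[X]} (hf : IsGenusTwoSextic f) : f.natDegree ≤ 6 := by
  rcases hf.1 with h | h <;> omega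

theorem IsGenusTwoSextic.sq_ne {f : k[X]} (hf : IsGenusTwoSextic f) (r : RatFunc k) :
    r ^ 2 ≠ algebraMap k[X] (RatFunc k) f := by
  intro h
  have hf0 := hf.ne_zero
  obtain ⟨p, hp⟩ := exists_polynomial_of_sq_mul_eq (g := 1) (D := f) squarefree_one
    (by rw [map_one, mul_one, h])
  have h1 : p ^ 2 = f := IsFractionRing.injective k[X] (RatFunc k) (by rw [map_pow, ← hp, h])
  have h2 : IsUnit p := hf.2 p ⟨1, by rw [← h1]; ring⟩
  have h3 := natDegree_eq_zero_of_isUnit h2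
  have h4 := hf.five_le
  rw [← h1, natDegree_pow, h3] at h4
  omega

instance irreducible_curve (f : k[X]) [hf : Fact (IsGenusTwoSextic f)] :
    Fact (Irreducible (X ^ 2 - C (algebraMap k[X] (RatFunc k) f) : (RatFunc k)[X])) :=
  ⟨(X_pow_sub_C_irreducible_iff_of_prime Nat.prime_two).2 hf.out.sq_ne⟩

/-- The coordinate function `X` of the curve `Y² = f(X)`. -/
def xGen (f : k[X]) : CurveField f := algebraMap (RatFunc k) (CurveField f) RatFunc.X

/-- The coordinate function `Y` of the curve `Y² = f(X)`. -/
def yGen (f : k[X]) : CurveField f := AdjoinRoot.root _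

theorem algebraMap_algebraMap_eq_aeval (f p : k[X]) :
    algebraMap (RatFunc k) (CurveField f) (algebraMap k[X] (RatFunc k) p) = aeval (xGen f) p := by
  have h : algebraMap k[X] (RatFunc k) p = aeval (RatFunc.X : RatFunc k) p := by
    rw [← RatFunc.algebraMap_X, aeval_algebraMap_apply, aeval_X_left_apply]
  rw [h, xGen, aeval_algebraMap_apply]

theorem yGen_sq (f : k[X]) : yGen f ^ 2 = aeval (xGen f) f := by
  have h := AdjoinRoot.eval₂_root (X ^ 2 - C (algebraMap k[X] (RatFunc k) f) : (RatFunc k)[X])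
  rw [eval₂_sub, eval₂_pow, eval₂_X, eval₂_C, sub_eq_zero] at h
  rw [← algebraMap_algebraMap_eq_aeval]
  exact h

section

variable (f : k[X]) [hf : Fact (IsGenusTwoSextic f)]

theorem exists_add_mul_yGen (z : CurveField f) : ∃ A B : RatFunc k,
    z = algebraMap (RatFunc k) (CurveField f) A +
      algebraMap (RatFunc k) (CurveField f) B * yGen f := by
  have hm : (X ^ 2 - C (algebraMap k[X] (RatFunc k) f) : (RatFunc k)[X]).Monic :=
    monic_X_pow_sub_C _ two_ne_zero
  obtain ⟨p, rfl⟩ := AdjoinRoot.mk_surjective z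
  have hdeg : (p %ₘ (X ^ 2 - C (algebraMap k[X] (RatFunc k) f))).natDegree ≤ 1 := by
    have := natDegree_modByMonic_lt p hm (by
      intro h
      have := congrArg natDegree h
      rw [natDegree_X_pow_sub_C] at this
      simp at this)
    rw [natDegree_X_pow_sub_C] at this
    omega
  obtain ⟨B, A, hAB⟩ := exists_eq_X_add_C_of_natDegree_le_one hdeg
  refine ⟨A, B, ?_⟩
  have : AdjoinRoot.mk (X ^ 2 - C (algebraMap k[X] (RatFunc k) f)) p =
      AdjoinRoot.mk _ (p %ₘ (X ^ 2 - C (algebraMap k[X] (RatFunc k) f))) := by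
    rw [AdjoinRoot.mk_eq_mk]
    exact ⟨p /ₘ (X ^ 2 - C (algebraMap k[X] (RatFunc k) f)), by
      linear_combination -modByMonic_add_div p (X ^ 2 - C (algebraMap k[X] (RatFunc k) f))⟩
  rw [this, hAB, map_add, map_mul, AdjoinRoot.mk_C, AdjoinRoot.mk_C, AdjoinRoot.mk_X, add_comm]
  rfl

theorem add_mul_yGen_eq_zero {A B : RatFunc k}
    (h : algebraMap (RatFunc k) (CurveField f) A +
      algebraMap (RatFunc k) (CurveField f) B * yGen f = 0) : A = 0 ∧ B = 0 := by
  have hinj := (algebraMap (RatFunc k) (CurveField f)).injective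
  have hB : B = 0 := by
    by_contra hB
    have hy : yGen f = algebraMap (RatFunc k) (CurveField f) (-A / B) := by
      have hB' : algebraMap (RatFunc k) (CurveField f) B ≠ 0 := by simpa using hB
      rw [map_div₀, map_neg, eq_div_iff hB']
      linear_combination h
    have h2 := yGen_sq f
    rw [hy, ← algebraMap_algebraMap_eq_aeval, ← map_pow] at h2
    exact hf.out.sq_ne _ (hinj h2)
  subst hB
  refine ⟨hinj ?_, rfl⟩
  simpa using h

theorem yGen_ne_zero : yGen f ≠ 0 := by
  intro h
  have := (add_mul_yGen_eq_zero f (A := 0) (B := 1) (by simp [h])).2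
  exact one_ne_zero this

theorem yGen_notMem_range (r : RatFunc k) :
    yGen f ≠ algebraMap (RatFunc k) (CurveField f) r := by
  intro h
  exact one_ne_zero (add_mul_yGen_eq_zero f (A := -r) (B := 1) (by rw [h, map_neg]; simp)).2

theorem curveField_algHom_ext {E : Type*} [Field E] [Algebra k E] {φ ψ : CurveField f →ₐ[k] E}
    (hx : φ (xGen f) = ψ (xGen f)) (hy : φ (yGen f) = ψ (yGen f)) : φ = ψ := by
  have hp : ∀ p : k[X], φ (algebraMap (RatFunc k) (CurveField f) (algebraMap k[X] _ p)) =
      ψ (algebraMap (RatFunc k) (CurveField f) (algebraMap k[X] _ p)) := by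
    intro p
    rw [algebraMap_algebraMap_eq_aeval, ← aeval_algHom_apply, ← aeval_algHom_apply, hx]
  have hr : ∀ r : RatFunc k, φ (algebraMap (RatFunc k) (CurveField f) r) =
      ψ (algebraMap (RatFunc k) (CurveField f) r) := by
    intro r
    rw [← RatFunc.num_div_denom r, map_div₀, map_div₀, map_div₀, hp, hp]
  refine AlgHom.ext fun z => ?_
  obtain ⟨A, B, rfl⟩ := exists_add_mul_yGen f z
  rw [map_add, map_add, map_mul, map_mul, hr, hr, hy]

theorem aeval_xGen_injective : Function.Injective (aeval (xGen f) : k[X] →ₐ[k] CurveField f) := by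
  intro p q h
  rw [← algebraMap_algebraMap_eq_aeval, ← algebraMap_algebraMap_eq_aeval] at h
  exact IsFractionRing.injective k[X] (RatFunc k)
    ((algebraMap (RatFunc k) (CurveField f)).injective h)

theorem exists_curveField_algHom {E : Type*} [Field E] [Algebra k E] (u v : E)
    (hu : Function.Injective (aeval u : k[X] →ₐ[k] E)) (hv : v ^ 2 = aeval u f) :
    ∃ φ : CurveField f →ₐ[k] E, φ (xGen f) = u ∧ φ (yGen f) = v := by
  let i : RatFunc k →ₐ[k] E := RatFunc.liftAlgHom (aeval u : k[X] →ₐ[k] E)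
    (nonZeroDivisors_le_comap_nonZeroDivisors_of_injective _ hu)
  have hi : ∀ p : k[X], i (algebraMap k[X] (RatFunc k) p) = aeval u p := fun p => by
    have h := RatFunc.liftAlgHom_apply_div' (aeval u : k[X] →ₐ[k] E)
      (nonZeroDivisors_le_comap_nonZeroDivisors_of_injective _ hu) p 1
    simpa using h
  refine ⟨AdjoinRoot.liftAlgHom _ i v ?_, ?_, ?_⟩
  · rw [eval₂_sub, eval₂_pow, eval₂_X, eval₂_C, hv, sub_eq_zero]
    exact (hi f).symm
  · rw [xGen, AdjoinRoot.algebraMap_eq, AdjoinRoot.liftAlgHom_of, ← RatFunc.algebraMap_X, hi,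
      aeval_X]
  · exact AdjoinRoot.liftAlgHom_root _ _ _ _

theorem intermediateField_eq_top_of_mem {S : IntermediateField k (CurveField f)}
    (hx : xGen f ∈ S) (hy : yGen f ∈ S) : S = ⊤ := by
  have hp : ∀ p : k[X], algebraMap (RatFunc k) (CurveField f) (algebraMap k[X] _ p) ∈ S := by
    intro p
    rw [algebraMap_algebraMap_eq_aeval, aeval_eq_sum_range]
    exact S.sum_mem fun i _ => S.smul_mem (pow_mem hx i)
  have hr : ∀ r : RatFunc k, algebraMap (RatFunc k) (CurveField f) r ∈ S := by
    intro r
    rw [← RatFunc.num_div_denom r, map_div₀]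
    exact S.div_mem (hp _) (hp _)
  rw [eq_top_iff]
  intro z _
  obtain ⟨A, B, rfl⟩ := exists_add_mul_yGen f z
  exact S.add_mem (hr _) (S.mul_mem (hr _) hy)

end

end FunctionField

/-! ### Linear substitutions in binary forms -/

section Moebius

variable {k : Type*} [Field k]

/-- The substitution `(X, Z) ↦ (aX + bZ, cX + dZ)` in the binary form of degree `n` whose
dehomogenization is `f`. -/
def moebius (n : ℕ) (a b c d : k) (f : k[X]) : k[X] :=
  ∑ i ∈ Finset.range (n + 1), C (f.coeff i) * (C a * X + C b) ^ i * (C c * X + C d) ^ (n - i)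

theorem natDegree_moebius_le (n : ℕ) (a b c d : k) (f : k[X]) :
    (moebius n a b c d f).natDegree ≤ n := by
  refine natDegree_sum_le_of_forall_le _ _ fun i hi => ?_
  have hi' : i ≤ n := by
    have := Finset.mem_range.1 hi
    omega
  have h1 : ((C a * X + C b : k[X]) ^ i).natDegree ≤ i := by
    simpa using natDegree_pow_le_of_le i (natDegree_linear_le (a := a) (b := b))
  have h2 : ((C c * X + C d : k[X]) ^ (n - i)).natDegree ≤ n - i := by
    simpa using natDegree_pow_le_of_le (n - i) (natDegree_linear_le (a := c) (b := d))
  have h3 := natDegree_mul_le_of_le (natDegree_C_mul_le (f.coeff i) ((C a * X + C b) ^ i)) h2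
  exact h3.trans (by omega)

theorem moebius_C_mul (n : ℕ) (a b c d e : k) (f : k[X]) :
    moebius n a b c d (C e * f) = C e * moebius n a b c d f := by
  simp only [moebius, Finset.mul_sum, coeff_C_mul, map_mul, mul_assoc]

/-- Homogeneity of degree n. At `RatFunc.X` this reduces identities between substitutions to
identities of fractions, as in the composition and product rules below. -/
theorem aeval_moebius {E : Type*} [Field E] [Algebra k E] {n : ℕ} (a b c d : k) {f : k[X]}
    (hf : f.natDegree ≤ n) {z : E} (hz : algebraMap k E c * z + algebraMap k E d ≠ 0) :
    aeval z (moebius n a b c d f) = (algebraMap k E c * z + algebraMap k E d) ^ n *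
      aeval ((algebraMap k E a * z + algebraMap k E b) /
        (algebraMap k E c * z + algebraMap k E d)) f := by
  rw [moebius, map_sum, aeval_eq_sum_range' (Nat.lt_succ_of_le hf), Finset.mul_sum]
  refine Finset.sum_congr rfl fun i hi => ?_
  have hi' : i ≤ n := by
    have := Finset.mem_range.1 hi
    omega
  simp only [map_mul, map_pow, map_add, aeval_C, aeval_X]
  rw [Algebra.smul_def, div_pow]
  obtain ⟨m, rfl⟩ := Nat.exists_eq_add_of_le hi'
  rw [Nat.add_sub_cancel_left, pow_add]
  generalize algebraMap k E c * z + algebraMap k E d = w at hz ⊢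
  field_simp

theorem aeval_ratFuncX (p : k[X]) : aeval (RatFunc.X : RatFunc k) p = algebraMap k[X] _ p := by
  rw [← RatFunc.algebraMap_X, aeval_algebraMap_apply, aeval_X_left_apply]

theorem aeval_ratFuncX_injective :
    Function.Injective (aeval (RatFunc.X : RatFunc k) : k[X] →ₐ[k] RatFunc k) := by
  intro p q h
  rw [aeval_ratFuncX, aeval_ratFuncX] at h
  exact IsFractionRing.injective k[X] (RatFunc k) h

theorem linear_ne_zero_of_injective {E : Type*} [Field E] [Algebra k E] {z : E}
    (hz : Function.Injective (aeval z : k[X] →ₐ[k] E)) {c d : k} (h : c ≠ 0 ∨ d ≠ 0) :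
    algebraMap k E c * z + algebraMap k E d ≠ 0 := by
  intro h0
  have h1 : aeval z (C c * X + C d) = aeval z (0 : k[X]) := by simpa using h0
  have h2 := hz h1
  have hc := congrArg (coeff · 1) h2
  have hd := congrArg (coeff · 0) h2
  simp at hc hd
  tauto

theorem moebius_moebius {n : ℕ} (a b c d a' b' c' d' : k) {f : k[X]} (hf : f.natDegree ≤ n)
    (h : a * d - b * c ≠ 0) (h' : a' * d' - b' * c' ≠ 0) :
    moebius n a' b' c' d' (moebius n a b c d f) =
      moebius n (a * a' + b * c') (a * b' + b * d') (c * a' + d * c') (c * b' + d * d') f := by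
  apply aeval_ratFuncX_injective
  have hinj := aeval_ratFuncX_injective (k := k)
  have h1 : algebraMap k (RatFunc k) c' * RatFunc.X + algebraMap k (RatFunc k) d' ≠ 0 := by
    refine linear_ne_zero_of_injective hinj ?_
    by_contra! hcon
    exact h' (by rw [hcon.1, hcon.2]; ring)
  have h2 : algebraMap k (RatFunc k) (c * a' + d * c') * RatFunc.X +
      algebraMap k (RatFunc k) (c * b' + d * d') ≠ 0 := by
    refine linear_ne_zero_of_injective hinj ?_
    by_contra! hcon
    have hc : c * (a' * d' - b' * c') = 0 := by linear_combination d' * hcon.1 - c' * hcon.2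
    have hd : d * (a' * d' - b' * c') = 0 := by linear_combination a' * hcon.2 - b' * hcon.1
    have hc0 := (mul_eq_zero.1 hc).resolve_right h'
    have hd0 := (mul_eq_zero.1 hd).resolve_right h'
    exact h (by rw [hc0, hd0]; ring)
  have h3 : algebraMap k (RatFunc k) c * ((algebraMap k (RatFunc k) a' * RatFunc.X +
      algebraMap k (RatFunc k) b') / (algebraMap k (RatFunc k) c' * RatFunc.X +
      algebraMap k (RatFunc k) d')) + algebraMap k (RatFunc k) d =
      (algebraMap k (RatFunc k) (c * a' + d * c') * RatFunc.X +
      algebraMap k (RatFunc k) (c * b' + d * d')) / (algebraMap k (RatFunc k) c' * RatFunc.X +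
      algebraMap k (RatFunc k) d') := by
    rw [mul_div_assoc', div_add' _ _ _ h1]
    congr 1
    simp only [map_add, map_mul]
    ring
  have h4 : algebraMap k (RatFunc k) a * ((algebraMap k (RatFunc k) a' * RatFunc.X +
      algebraMap k (RatFunc k) b') / (algebraMap k (RatFunc k) c' * RatFunc.X +
      algebraMap k (RatFunc k) d')) + algebraMap k (RatFunc k) b =
      (algebraMap k (RatFunc k) (a * a' + b * c') * RatFunc.X +
      algebraMap k (RatFunc k) (a * b' + b * d')) / (algebraMap k (RatFunc k) c' * RatFunc.X +
      algebraMap k (RatFunc k) d') := by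
    rw [mul_div_assoc', div_add' _ _ _ h1]
    congr 1
    simp only [map_add, map_mul]
    ring
  rw [aeval_moebius _ _ _ _ (natDegree_moebius_le _ _ _ _ _ _) h1, aeval_moebius _ _ _ _ hf h2,
    aeval_moebius _ _ _ _ hf, h3, h4, div_div_div_cancel_right₀ h1, ← mul_assoc, ← mul_pow,
    mul_div_cancel₀ _ h1]
  rw [h3]
  exact div_ne_zero h2 h1

theorem moebius_mul {n m : ℕ} (a b c d : k) {p q : k[X]} (hp : p.natDegree ≤ n)
    (hq : q.natDegree ≤ m) (h : a * d - b * c ≠ 0) :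
    moebius (n + m) a b c d (p * q) = moebius n a b c d p * moebius m a b c d q := by
  apply aeval_ratFuncX_injective
  have h1 : algebraMap k (RatFunc k) c * RatFunc.X + algebraMap k (RatFunc k) d ≠ 0 := by
    refine linear_ne_zero_of_injective aeval_ratFuncX_injective ?_
    by_contra! hcon
    exact h (by rw [hcon.1, hcon.2]; ring)
  rw [map_mul, aeval_moebius _ _ _ _ (natDegree_mul_le_of_le hp hq) h1,
    aeval_moebius _ _ _ _ hp h1, aeval_moebius _ _ _ _ hq h1, map_mul]
  ring

theorem moebius_scalar {n : ℕ} {s : k} (hs : s ≠ 0) {f : k[X]} (hf : f.natDegree ≤ n) :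
    moebius n s 0 0 s f = C (s ^ n) * f := by
  apply aeval_ratFuncX_injective
  have hs' : algebraMap k (RatFunc k) s ≠ 0 := by simpa using hs
  rw [aeval_moebius _ _ _ _ hf (by simpa using hs)]
  simp only [map_zero, zero_mul, zero_add, add_zero, map_mul, map_pow, aeval_C]
  rw [mul_div_cancel_left₀ _ hs']

theorem moebius_adjugate {n : ℕ} {a b c d : k} (h : a * d - b * c ≠ 0) {f : k[X]}
    (hf : f.natDegree ≤ n) :
    moebius n d (-b) (-c) a (moebius n a b c d f) = C ((a * d - b * c) ^ n) * f := by
  rw [moebius_moebius _ _ _ _ _ _ _ _ hf h (by convert h using 1; ring), ← moebius_scalar h hf]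
  congr 1 <;> ring

theorem IsGenusTwoSextic.C_mul {f : k[X]} (hf : IsGenusTwoSextic f) {e : k} (he : e ≠ 0) :
    IsGenusTwoSextic (C e * f) := by
  have hu : IsUnit (C e : k[X]) := isUnit_C.2 he.isUnit
  refine ⟨by rw [natDegree_C_mul he]; exact hf.1, ?_⟩
  intro x hx
  exact hf.2 x (hu.dvd_mul_left.1 hx)

/-- A repeated linear factor of the transformed form, possibly Z, is carried back by the adjugate
matrix to a square factor of a nonzero multiple of f. -/
theorem IsGenusTwoSextic.moebius {f : k[X]} (hf : IsGenusTwoSextic f) {a b c d : k}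
    (h : a * d - b * c ≠ 0) : IsGenusTwoSextic (moebius 6 a b c d f) := by
  have h' : d * a - -b * -c ≠ 0 := by convert h using 1; ring
  have hD : (a * d - b * c) ^ 6 ≠ 0 := pow_ne_zero _ h
  have hadj := moebius_adjugate h hf.le_six
  have hF := hf.C_mul hD
  rw [← hadj] at hF
  have hdeg := natDegree_moebius_le 6 a b c d f
  generalize GenusTwo.moebius 6 a b c d f = g at hF hdeg
  -- The bound on p also covers a repeated factor that becomes constant (the form Z): the degree
  -- then drops below 5.
  have key : ∀ p q : k[X], p.natDegree ≤ 4 →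
      q * q * p ≠ GenusTwo.moebius 6 d (-b) (-c) a g := by
    intro p q hp hpq
    have hq := natDegree_eq_zero_of_isUnit (hF.2 q ⟨p, hpq.symm⟩)
    have h5 := hF.five_le
    rw [← hpq] at h5
    have h6 := natDegree_mul_le_of_le (natDegree_mul_le_of_le hq.le hq.le) hp
    omega
  refine ⟨?_, ?_⟩
  · by_contra hcon
    have h4 : g.natDegree ≤ 4 := by omega
    refine key (GenusTwo.moebius 4 d (-b) (-c) a g) (C (-c) * X + C a)
      (natDegree_moebius_le _ _ _ _ _ _) ?_
    -- Degree at most 4 means that Z² divides the sextic form; in degree 2 the polynomial 1 stands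
    -- for Z².
    have h1 : GenusTwo.moebius 2 d (-b) (-c) a (1 : k[X]) = (C (-c) * X + C a) ^ 2 := by
      simp [GenusTwo.moebius, coeff_one]
    have h2 := moebius_mul (n := 2) (m := 4) d (-b) (-c) a (p := 1) (q := g) (by simp) h4 h'
    rw [one_mul, h1] at h2
    rw [← sq, ← h2]
  · rintro p ⟨q, rfl⟩
    by_contra hp
    have hne : p * p * q ≠ 0 := by
      intro h0
      rw [h0] at hF
      exact hF.ne_zero (by simp [GenusTwo.moebius])
    have hp0 : p ≠ 0 := by rintro rfl; simp at hne
    have hq0 : q ≠ 0 := by rintro rfl; simp at hne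
    have hp1 : 1 ≤ p.natDegree := by
      by_contra hcon
      have : p.natDegree = 0 := by omega
      rw [natDegree_eq_zero] at this
      obtain ⟨x, rfl⟩ := this
      exact hp (isUnit_C.2 (by simpa using hp0))
    rw [natDegree_mul (mul_ne_zero hp0 hp0) hq0, natDegree_mul hp0 hp0] at hdeg
    obtain ⟨m, hm⟩ := Nat.exists_eq_add_of_le hdeg
    have h1 := moebius_mul (n := p.natDegree + p.natDegree) (m := q.natDegree + m) d (-b) (-c) a
      (p := p * p) (q := q) natDegree_mul_le (by omega) h'
    rw [moebius_mul (n := p.natDegree) (m := p.natDegree) d (-b) (-c) a le_rfl le_rfl h',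
      ← add_assoc, ← hm] at h1
    refine key _ _ ?_ h1.symm
    exact (natDegree_moebius_le _ _ _ _ _ _).trans (by omega)

end Moebius

/-! ### Degrees in the inner variable of a bivariate polynomial -/

section Bivariate

variable {k : Type*} [Field k]

theorem coeff_coeff_swap (P : k[X][X]) (i j : ℕ) :
    ((Bivariate.swap P).coeff i).coeff j = (P.coeff j).coeff i := by
  induction P using Polynomial.induction_on' with
  | add p q hp hq => simp only [map_add, coeff_add, hp, hq]
  | monomial n p =>
    induction p using Polynomial.induction_on' with
    | add p q hp hq => simp only [map_add, coeff_add, hp, hq]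
    | monomial m r =>
      rw [Bivariate.swap_monomial_monomial]
      simp only [coeff_monomial]
      split_ifs <;> simp_all [coeff_monomial]

theorem natDegree_swap_le_iff (P : k[X][X]) (m : ℕ) :
    (Bivariate.swap P).natDegree ≤ m ↔ ∀ j, (P.coeff j).natDegree ≤ m := by
  constructor
  · intro h j
    rw [natDegree_le_iff_coeff_eq_zero]
    intro i hi
    rw [← coeff_coeff_swap, coeff_eq_zero_of_natDegree_lt (p := Bivariate.swap P) (by omega),
      coeff_zero]
  · intro h
    rw [natDegree_le_iff_coeff_eq_zero]
    intro i hi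
    ext j
    rw [coeff_coeff_swap, coeff_zero]
    exact coeff_eq_zero_of_natDegree_lt (lt_of_le_of_lt (h j) hi)

/-- After exchanging the two variables this is the degree bound for a divisor over a domain. -/
theorem natDegree_coeff_le_of_dvd {F G : k[X][X]} (h : F ∣ G) (hG : G ≠ 0) {m : ℕ}
    (hm : ∀ j, (G.coeff j).natDegree ≤ m) (j : ℕ) : (F.coeff j).natDegree ≤ m := by
  revert j
  rw [← natDegree_swap_le_iff] at hm ⊢
  refine (natDegree_le_of_dvd (map_dvd Bivariate.swap h) ?_).trans hm
  simpa using hG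

end Bivariate

/-! ### Uniqueness of the rational subfield of index 2 -/

section Hyperelliptic

variable {k : Type*} [Field k]

theorem exists_common_denominator (f : k[X]) [Fact (IsGenusTwoSextic f)] (z : CurveField f) :
    ∃ n a b : k[X], n ≠ 0 ∧
      aeval (xGen f) n * z = aeval (xGen f) a + aeval (xGen f) b * yGen f := by
  obtain ⟨A, B, rfl⟩ := exists_add_mul_yGen f z
  refine ⟨A.denom * B.denom, A.num * B.denom, B.num * A.denom,
    mul_ne_zero A.denom_ne_zero B.denom_ne_zero, ?_⟩
  have hA : algebraMap k[X] (RatFunc k) A.denom ≠ 0 := by simpa using A.denom_ne_zero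
  have hB : algebraMap k[X] (RatFunc k) B.denom ≠ 0 := by simpa using B.denom_ne_zero
  have h1 : algebraMap k[X] (RatFunc k) (A.denom * B.denom) * A =
      algebraMap k[X] (RatFunc k) (A.num * B.denom) := by
    nth_rewrite 2 [← RatFunc.num_div_denom A]
    rw [map_mul, map_mul]
    field_simp
  have h2 : algebraMap k[X] (RatFunc k) (A.denom * B.denom) * B =
      algebraMap k[X] (RatFunc k) (B.num * A.denom) := by
    nth_rewrite 2 [← RatFunc.num_div_denom B]
    rw [map_mul, map_mul]
    field_simp
  simp only [← algebraMap_algebraMap_eq_aeval]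
  rw [← h1, ← h2]
  simp only [map_mul]
  ring

/-- By Gauss's lemma the primitive part F of F₀ divides G over k[X], so its coefficients have degree
at most 2 and its discriminant D at most 4. The discriminant of F₀ is (2nb)²g, so D is g times a
nonzero square in k(X), which is the square of a polynomial because g is squarefree. -/
theorem natDegree_le_four_of_dvd [CharZero k] {g n a b : k[X]} (hg : Squarefree g) (hn : n ≠ 0)
    (hb : b ≠ 0) {F₀ G : k[X][X]} (h₂ : F₀.coeff 2 = n ^ 2) (h₁ : F₀.coeff 1 = -(2 * a * n))
    (h₀ : F₀.coeff 0 = a ^ 2 - b ^ 2 * g) (hG0 : G ≠ 0) (hGdeg : ∀ i, (G.coeff i).natDegree ≤ 2)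
    (hdvd₀ : F₀.map (algebraMap k[X] (RatFunc k)) ∣ G.map (algebraMap k[X] (RatFunc k))) :
    g.natDegree ≤ 4 := by
  obtain ⟨inst⟩ : Nonempty (NormalizedGCDMonoid k[X]) := inferInstance
  obtain ⟨c, F, hF, hF₀F⟩ : ∃ (c : k[X]) (F : k[X][X]), F.IsPrimitive ∧ F₀ = C c * F :=
    ⟨F₀.content, F₀.primPart, isPrimitive_primPart F₀, F₀.eq_C_content_mul_primPart⟩
  have hFdvd : F ∣ G := by
    refine hF.dvd_of_fraction_map_dvd_fraction_map (K := RatFunc k) ?_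
    refine dvd_trans ?_ hdvd₀
    rw [hF₀F, Polynomial.map_mul]
    exact dvd_mul_left _ _
  have hFdeg := natDegree_coeff_le_of_dvd hFdvd hG0 hGdeg
  have hcF : ∀ i, F₀.coeff i = c * F.coeff i := by
    intro i
    rw [hF₀F, coeff_C_mul]
  have h2 := hcF 2
  have h1 := hcF 1
  have h0 := hcF 0
  rw [h₂] at h2
  rw [h₁] at h1
  rw [h₀] at h0
  have hc0 : c ≠ 0 := by
    rintro hc0
    rw [hc0, zero_mul] at h2
    exact pow_ne_zero 2 hn h2
  have hc0' : algebraMap k[X] (RatFunc k) c ≠ 0 := by simpa using hc0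
  set D := F.coeff 1 ^ 2 - 4 * F.coeff 2 * F.coeff 0 with hD
  have hcD : c ^ 2 * D = (2 * n * b) ^ 2 * g := by
    rw [hD]
    linear_combination -(c * F.coeff 1 - 2 * a * n) * h1 + 4 * c * F.coeff 0 * h2 + 4 * n ^ 2 * h0
  have hDdeg : D.natDegree ≤ 4 := by
    refine (natDegree_sub_le_of_le (natDegree_pow_le_of_le 2 (hFdeg 1))
      (natDegree_mul_le_of_le (natDegree_mul_le_of_le (n := 2) (m := 0) ?_ (hFdeg 2))
      (hFdeg 0))).trans (by norm_num)
    exact (natDegree_ofNat 4).le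
  obtain ⟨p, hp⟩ := exists_polynomial_of_sq_mul_eq (g := g) (D := D) hg
    (r := algebraMap k[X] (RatFunc k) (2 * n * b) / algebraMap k[X] (RatFunc k) c) (by
      have := congrArg (algebraMap k[X] (RatFunc k)) hcD
      simp only [map_mul, map_pow] at this ⊢
      field_simp
      linear_combination -this)
  have hcp : 2 * n * b = p * c := by
    apply IsFractionRing.injective k[X] (RatFunc k)
    rw [div_eq_iff hc0'] at hp
    rw [hp, map_mul]
  have hp0 : p ≠ 0 := by
    rintro rfl
    rw [zero_mul] at hcp
    exact mul_ne_zero (mul_ne_zero two_ne_zero hn) hb hcp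
  have hDp : D = p ^ 2 * g := by
    apply mul_left_cancel₀ (pow_ne_zero 2 hc0)
    rw [hcD, hcp]
    ring
  rw [hDp, natDegree_mul (pow_ne_zero 2 hp0) hg.ne_zero] at hDdeg
  omega

/-- If `U` is not a rational function of `X`, then `X` is not quadratic over `k(U)`: the
relation between `X` and `U` would have bidegree `(2, 2)`, whose discriminant has degree `≤ 4`. -/
theorem quadratic_relation_ne_zero [CharZero k] (g : k[X]) [hg : Fact (IsGenusTwoSextic g)]
    {U : CurveField g} {n a b : k[X]} (hn : n ≠ 0) (hb : b ≠ 0)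
    (hU : aeval (xGen g) n * U = aeval (xGen g) a + aeval (xGen g) b * yGen g)
    {q₀ q₁ q₂ : k[X]} (hq : q₂ ≠ 0) :
    aeval U q₂ * xGen g ^ 2 + aeval U q₁ * xGen g + aeval U q₀ ≠ 0 := by
  intro hrel
  let j : k[X] →+* CurveField g := (aeval (xGen g) : k[X] →ₐ[k] CurveField g)
  have hj : j = (algebraMap (RatFunc k) (CurveField g)).comp (algebraMap k[X] (RatFunc k)) := by
    ext p
    · simp only [j, RingHom.comp_apply, algebraMap_algebraMap_eq_aeval, RingHom.coe_coe]
    · simp [j, xGen]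
  have hjC : j.comp C = algebraMap k (CurveField g) := by
    ext x
    simp [j]
  -- The relation is rewritten with U as outer variable; its coefficients in k[X] have degree at
  -- most 2.
  let G : k[X][X] := q₀.map C + q₁.map C * C X + q₂.map C * C (X ^ 2)
  have hGc : ∀ i, G.coeff i = C (q₀.coeff i) + C (q₁.coeff i) * X + C (q₂.coeff i) * X ^ 2 := by
    intro i
    simp only [G, coeff_add, coeff_map, coeff_mul_C]
  have hGdeg : ∀ i, (G.coeff i).natDegree ≤ 2 := by
    intro i
    rw [hGc]
    compute_degree
  have hG0 : G ≠ 0 := by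
    intro h0
    apply hq
    ext i
    have := congrArg (coeff · 2) (hGc i)
    simp [h0] at this
    simp [← this]
  have hGU : eval₂ j U G = 0 := by
    simp only [G, eval₂_add, eval₂_mul, eval₂_C, eval₂_map, hjC]
    rw [← hrel]
    simp only [aeval_def, j, RingHom.coe_coe, eval₂_X, eval₂_X_pow]
    ring
  -- With T the outer variable, this is (nT − a)² − b²g, the minimal polynomial of U over k(X) up to
  -- the factor n².
  let F₀ : k[X][X] := C (n ^ 2) * X ^ 2 + C (-(2 * a * n)) * X + C (a ^ 2 - b ^ 2 * g)
  have hF₀c : F₀.coeff 2 = n ^ 2 ∧ F₀.coeff 1 = -(2 * a * n) ∧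
      F₀.coeff 0 = a ^ 2 - b ^ 2 * g := by
    refine ⟨?_, ?_, ?_⟩ <;> simp only [F₀] <;> simp [coeff_X, coeff_C, -map_mul, -map_neg, -map_pow]
  have hF₀U : eval₂ j U F₀ = 0 := by
    simp only [F₀, eval₂_add, eval₂_mul, eval₂_C, eval₂_X_pow, eval₂_X]
    simp only [j, RingHom.coe_coe, map_sub, map_mul, map_neg, map_pow, map_ofNat]
    rw [← yGen_sq]
    linear_combination (aeval (xGen g) n * U - aeval (xGen g) a + aeval (xGen g) b * yGen g) * hU
  have hF₀deg : (F₀.map (algebraMap k[X] (RatFunc k))).natDegree = 2 := by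
    rw [natDegree_map_eq_of_injective (IsFractionRing.injective k[X] (RatFunc k))]
    exact natDegree_quadratic (pow_ne_zero 2 hn)
  have hF₀ne : F₀.map (algebraMap k[X] (RatFunc k)) ≠ 0 := by
    intro h
    rw [h] at hF₀deg
    simp at hF₀deg
  -- The remainder αT + β vanishes at U, which has a nonzero Y-component since b ≠ 0; so α = β = 0.
  have hdvd₀ : F₀.map (algebraMap k[X] (RatFunc k)) ∣ G.map (algebraMap k[X] (RatFunc k)) := by
    rw [← EuclideanDomain.mod_eq_zero]
    set R := G.map (algebraMap k[X] (RatFunc k)) % F₀.map (algebraMap k[X] (RatFunc k)) with hR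
    have hRdeg : R.natDegree ≤ 1 := by
      have := natDegree_mod_lt (G.map (algebraMap k[X] (RatFunc k)))
        (q := F₀.map (algebraMap k[X] (RatFunc k))) (by omega)
      rw [← hR] at this
      omega
    have hRU : eval₂ (algebraMap (RatFunc k) (CurveField g)) U R = 0 := by
      have h1 := EuclideanDomain.mod_add_div (G.map (algebraMap k[X] (RatFunc k)))
        (F₀.map (algebraMap k[X] (RatFunc k)))
      have h2 := congrArg (eval₂ (algebraMap (RatFunc k) (CurveField g)) U) h1
      rw [eval₂_add, eval₂_mul, eval₂_map, eval₂_map, ← hj, hGU, hF₀U, zero_mul, add_zero] at h2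
      exact h2
    obtain ⟨α, β, hαβ⟩ := exists_eq_X_add_C_of_natDegree_le_one hRdeg
    rw [hαβ] at hRU ⊢
    simp only [eval₂_add, eval₂_mul, eval₂_C, eval₂_X] at hRU
    simp only [← algebraMap_algebraMap_eq_aeval] at hU
    have h3 := add_mul_yGen_eq_zero g (A := α * algebraMap k[X] _ a + β * algebraMap k[X] _ n)
      (B := α * algebraMap k[X] _ b) (by
        simp only [map_add, map_mul]
        linear_combination algebraMap (RatFunc k) (CurveField g) (algebraMap k[X] (RatFunc k) n) *
          hRU - algebraMap (RatFunc k) (CurveField g) α * hU)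
    have hα : α = 0 := (mul_eq_zero.1 h3.2).resolve_right (by simpa using hb)
    have hβ : β = 0 := by
      have := h3.1
      rw [hα, zero_mul, zero_add] at this
      exact (mul_eq_zero.1 this).resolve_right (by simpa using hn)
    simp [hα, hβ]
  have h4 := natDegree_le_four_of_dvd hg.out.2 hn hb hF₀c.1 hF₀c.2.1 hF₀c.2.2 hG0 hGdeg hdvd₀
  have h5 := hg.out.five_le
  omega

end Hyperelliptic

/-! ### Isomorphisms are fractional linear -/

section Isomorphisms

variable {k : Type*} [Field k]

/-- The inverse isomorphism makes X quadratic over k(U), where U is the image of X; this is excluded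
when U has a Y-component. -/
theorem exists_algEquiv_xGen_eq [CharZero k] {f g : k[X]} [Fact (IsGenusTwoSextic f)]
    [Fact (IsGenusTwoSextic g)] (σ : CurveField f ≃ₐ[k] CurveField g) :
    ∃ u : RatFunc k, σ (xGen f) = algebraMap (RatFunc k) (CurveField g) u := by
  obtain ⟨n, a, b, hn, hU⟩ := exists_common_denominator g (σ (xGen f))
  by_cases hb : b = 0
  · refine ⟨algebraMap k[X] _ a / algebraMap k[X] _ n, ?_⟩
    have hn' : algebraMap (RatFunc k) (CurveField g) (algebraMap k[X] _ n) ≠ 0 := by simpa using hn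
    rw [hb, map_zero, zero_mul, add_zero, ← algebraMap_algebraMap_eq_aeval,
      ← algebraMap_algebraMap_eq_aeval] at hU
    rw [map_div₀, eq_div_iff hn', ← hU, mul_comm]
  · exfalso
    obtain ⟨n', a', b', hn', hV⟩ := exists_common_denominator f (σ.symm (xGen g))
    -- These are the coefficients of (n'T − a')² − b'²f, which vanishes at the preimage of X; they
    -- are transported by σ.
    refine quadratic_relation_ne_zero g hn hb hU (q₂ := n' ^ 2) (q₁ := -(2 * a' * n'))
      (q₀ := a' ^ 2 - b' ^ 2 * f) (pow_ne_zero 2 hn') ?_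
    have hy := congrArg σ (yGen_sq f)
    have hV' := congrArg σ hV
    simp only [map_add, map_mul, map_pow, AlgEquiv.apply_symm_apply, ← aeval_algHom_apply]
      at hV' hy
    simp only [map_sub, map_mul, map_neg, map_pow, map_ofNat]
    rw [← hy]
    linear_combination (aeval (σ (xGen f)) n' * xGen g - aeval (σ (xGen f)) a' +
      aeval (σ (xGen f)) b' * σ (yGen f)) * hV'

/-- The inverse also preserves the rational subfields, so X is a rational function of u. -/
theorem adjoin_eq_top_of_algEquiv [CharZero k] {f g : k[X]} [Fact (IsGenusTwoSextic f)]
    [Fact (IsGenusTwoSextic g)] (σ : CurveField f ≃ₐ[k] CurveField g) {u : RatFunc k}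
    (hu : σ (xGen f) = algebraMap (RatFunc k) (CurveField g) u) :
    IntermediateField.adjoin k {u} = ⊤ := by
  obtain ⟨w, hw⟩ := exists_algEquiv_xGen_eq σ.symm
  let φ : RatFunc k →ₐ[k] CurveField g :=
    σ.toAlgHom.comp (IsScalarTower.toAlgHom k (RatFunc k) (CurveField f))
  let ψ : RatFunc k →ₐ[k] CurveField g := IsScalarTower.toAlgHom k (RatFunc k) (CurveField g)
  have h1 : (IntermediateField.adjoin k {u}).map ψ =
      (IntermediateField.adjoin k {(RatFunc.X : RatFunc k)}).map φ := by
    rw [IntermediateField.adjoin_map, IntermediateField.adjoin_map, Set.image_singleton,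
      Set.image_singleton]
    congr 2
    exact hu.symm
  rw [RatFunc.adjoin_X] at h1
  have h2 : xGen g ∈ (⊤ : IntermediateField k (RatFunc k)).map φ := by
    refine ⟨w, trivial, ?_⟩
    change σ (algebraMap (RatFunc k) (CurveField f) w) = xGen g
    rw [← hw, AlgEquiv.apply_symm_apply]
  rw [← h1] at h2
  obtain ⟨r, hr, hrx⟩ := h2
  have h3 : r = RatFunc.X := (algebraMap (RatFunc k) (CurveField g)).injective hrx
  rw [eq_top_iff, ← RatFunc.adjoin_X, IntermediateField.adjoin_le_iff, Set.singleton_subset_iff,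
    ← h3]
  exact hr

/-- The degree of k(X) over k(u) is the larger of the degrees of numerator and denominator, here 1.
Vanishing determinant would make these two proportional, contrary to coprimality. -/
theorem exists_linear_fractional_of_adjoin_eq_top {u : RatFunc k}
    (hu : IntermediateField.adjoin k {u} = ⊤) : ∃ a b c d : k, a * d - b * c ≠ 0 ∧
      u * algebraMap k[X] (RatFunc k) (C c * X + C d) =
        algebraMap k[X] (RatFunc k) (C a * X + C b) := by
  have h1 := RatFunc.finrank_eq_max_natDegree u
  rw [hu, IntermediateField.finrank_top] at h1
  obtain ⟨a, b, hab⟩ := exists_eq_X_add_C_of_natDegree_le_one (p := u.num)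
    ((le_max_left _ _).trans h1.symm.le)
  obtain ⟨c, d, hcd⟩ := exists_eq_X_add_C_of_natDegree_le_one (p := u.denom)
    ((le_max_right _ _).trans h1.symm.le)
  have hden : algebraMap k[X] (RatFunc k) u.denom ≠ 0 := by simpa using u.denom_ne_zero
  refine ⟨a, b, c, d, ?_, ?_⟩
  · intro hdet
    obtain ⟨s, t, hst⟩ := RatFunc.isCoprime_num_denom u
    have hcop : ∀ p q : k, p * a + q * c = 0 → p * b + q * d = 0 →
        C p * u.num + C q * u.denom = 0 := by
      intro p q h h'
      rw [hab, hcd]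
      calc C p * (C a * X + C b) + C q * (C c * X + C d) =
          C (p * a + q * c) * X + C (p * b + q * d) := by simp only [map_add, map_mul]; ring
        _ = 0 := by rw [h, h']; simp
    have key : ∀ p q : k, C p * u.num + C q * u.denom = 0 → p = 0 ∧ q = 0 := by
      intro p q h
      have hmax : ¬(u.num.natDegree = 0 ∧ u.denom.natDegree = 0) := by
        rintro ⟨h2, h3⟩
        rw [h2, h3] at h1
        simp at h1
      by_cases hp : p = 0
      · refine ⟨hp, ?_⟩
        rw [hp, map_zero, zero_mul, zero_add] at h
        exact C_eq_zero.1 ((mul_eq_zero.1 h).resolve_right u.denom_ne_zero)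
      · exfalso
        have hun : u.num = C (-q / p) * u.denom := by
          have : C p * u.num = C p * (C (-q / p) * u.denom) := by
            rw [← mul_assoc, ← map_mul, mul_div_cancel₀ _ hp, map_neg]
            linear_combination h
          exact mul_left_cancel₀ (C_ne_zero.2 hp) this
        have hunit : IsUnit u.denom := by
          refine IsUnit.of_mul_eq_one (s * C (-q / p) + t) ?_
          rw [← hst]
          linear_combination -s * hun
        have hd0 := natDegree_eq_zero_of_isUnit hunit
        refine hmax ⟨?_, hd0⟩
        rw [hun]
        exact Nat.le_zero.1 ((natDegree_C_mul_le _ _).trans hd0.le)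
    have h2 := key c (-a) (hcop _ _ (by ring) (by linear_combination -hdet))
    have h3 := key d (-b) (hcop _ _ (by linear_combination hdet) (by ring))
    apply u.denom_ne_zero
    rw [hcd, h2.1, h3.1]
    simp
  · rw [← hab, ← hcd]
    nth_rewrite 1 [← RatFunc.num_div_denom u]
    rw [div_mul_cancel₀ _ hden]

theorem linear_xGen_ne_zero (f : k[X]) [Fact (IsGenusTwoSextic f)] {a b c d : k}
    (h : a * d - b * c ≠ 0) :
    algebraMap k (CurveField f) c * xGen f + algebraMap k (CurveField f) d ≠ 0 := by
  refine linear_ne_zero_of_injective (aeval_xGen_injective f) ?_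
  by_contra! hcon
  exact h (by rw [hcon.1, hcon.2]; ring)

/-- The isomorphism `σ` of function fields is given by
`X ↦ (aX + b) / (cX + d)`, `Y ↦ eY / (cX + d)³`. -/
structure IsGivenBy {f g : k[X]} (σ : CurveField f ≃ₐ[k] CurveField g) (a b c d e : k) : Prop where
  det_ne_zero : a * d - b * c ≠ 0
  scale_ne_zero : e ≠ 0
  map_xGen : σ (xGen f) * (algebraMap k (CurveField g) c * xGen g + algebraMap k (CurveField g) d) =
    algebraMap k (CurveField g) a * xGen g + algebraMap k (CurveField g) b
  map_yGen : σ (yGen f) *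
    (algebraMap k (CurveField g) c * xGen g + algebraMap k (CurveField g) d) ^ 3 =
      algebraMap k (CurveField g) e * yGen g
  moebius_eq : moebius 6 a b c d f = C (e ^ 2) * g

/-- Write the image of Y as A + BY and w = cX + d. Its square lies in k(X), so AB = 0. Then (Bw³)²g
is the transformed sextic, so Bw³ is a polynomial, and comparing degrees makes it a constant e. -/
theorem exists_isGivenBy [CharZero k] {f g : k[X]} [hf : Fact (IsGenusTwoSextic f)]
    [hg : Fact (IsGenusTwoSextic g)] (σ : CurveField f ≃ₐ[k] CurveField g) :
    ∃ a b c d e : k, IsGivenBy σ a b c d e := by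
  obtain ⟨u, hu⟩ := exists_algEquiv_xGen_eq σ
  obtain ⟨a, b, c, d, hdet, habcd⟩ :=
    exists_linear_fractional_of_adjoin_eq_top (adjoin_eq_top_of_algEquiv σ hu)
  have hW := linear_xGen_ne_zero g hdet
  have hx : σ (xGen f) * (algebraMap k (CurveField g) c * xGen g + algebraMap k (CurveField g) d) =
      algebraMap k (CurveField g) a * xGen g + algebraMap k (CurveField g) b := by
    have := congrArg (algebraMap (RatFunc k) (CurveField g)) habcd
    rw [map_mul, ← hu, algebraMap_algebraMap_eq_aeval, algebraMap_algebraMap_eq_aeval] at this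
    simpa using this
  have hx' := (eq_div_iff hW).2 hx
  obtain ⟨A, B, hAB⟩ := exists_add_mul_yGen g (σ (yGen f))
  have hy2 : σ (yGen f) ^ 2 *
      (algebraMap k (CurveField g) c * xGen g + algebraMap k (CurveField g) d) ^ 6 =
      aeval (xGen g) (moebius 6 a b c d f) := by
    rw [aeval_moebius _ _ _ _ hf.out.le_six hW, ← hx', ← map_pow, yGen_sq, ← aeval_algHom_apply,
      mul_comm]
  set w : k[X] := C c * X + C d with hw
  have hWw : algebraMap k (CurveField g) c * xGen g + algebraMap k (CurveField g) d =
      algebraMap (RatFunc k) (CurveField g) (algebraMap k[X] _ w) := by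
    rw [algebraMap_algebraMap_eq_aeval]
    simp [hw]
  have hw0 : algebraMap k[X] (RatFunc k) w ≠ 0 := by
    intro h0
    rw [hWw, h0, map_zero] at hW
    exact hW rfl
  rw [hAB, hWw, ← algebraMap_algebraMap_eq_aeval] at hy2
  have h3 := add_mul_yGen_eq_zero g
    (A := (A ^ 2 + B ^ 2 * algebraMap k[X] _ g) * algebraMap k[X] _ w ^ 6 -
      algebraMap k[X] _ (moebius 6 a b c d f))
    (B := 2 * A * B * algebraMap k[X] _ w ^ 6) (by
      have hyg := yGen_sq g
      rw [← algebraMap_algebraMap_eq_aeval] at hyg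
      simp only [map_add, map_mul, map_sub, map_pow, map_ofNat]
      linear_combination hy2 - algebraMap (RatFunc k) (CurveField g) B ^ 2 *
        algebraMap (RatFunc k) (CurveField g) (algebraMap k[X] _ w) ^ 6 * hyg)
  -- If B = 0, the whole image of σ would lie in k(X), and Y would be missed.
  have hB : B ≠ 0 := by
    rintro rfl
    rw [map_zero, zero_mul, add_zero] at hAB
    have hmem : (⊤ : IntermediateField k (CurveField f)) =
        (IsScalarTower.toAlgHom k (RatFunc k) (CurveField g)).fieldRange.comap σ.toAlgHom := by
      symm
      apply intermediateField_eq_top_of_mem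
      · exact ⟨u, hu.symm⟩
      · exact ⟨A, hAB.symm⟩
    have : σ.symm (yGen g) ∈ (⊤ : IntermediateField k (CurveField f)) := trivial
    rw [hmem] at this
    obtain ⟨r, hr⟩ := this
    refine yGen_notMem_range g r ?_
    have h5 : algebraMap (RatFunc k) (CurveField g) r = σ (σ.symm (yGen g)) := hr
    rw [h5, AlgEquiv.apply_symm_apply]
  have hA : A = 0 := by
    have h4 := h3.2
    simpa [hB, hw0] using h4
  have h5 : (B * algebraMap k[X] _ w ^ 3) ^ 2 * algebraMap k[X] (RatFunc k) g =
      algebraMap k[X] _ (moebius 6 a b c d f) := by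
    have h4 := h3.1
    rw [hA] at h4
    linear_combination h4
  obtain ⟨p, hp⟩ := exists_polynomial_of_sq_mul_eq hg.out.2 h5
  have h6 : p ^ 2 * g = moebius 6 a b c d f := by
    apply IsFractionRing.injective k[X] (RatFunc k)
    rw [map_mul, map_pow, ← hp, h5]
  have hp0 : p ≠ 0 := by
    rintro rfl
    rw [map_zero] at hp
    exact mul_ne_zero hB (pow_ne_zero 3 hw0) hp
  have h7 := natDegree_moebius_le 6 a b c d f
  rw [← h6, natDegree_mul (pow_ne_zero 2 hp0) hg.out.ne_zero, natDegree_pow] at h7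
  have h8 := hg.out.five_le
  obtain ⟨e, rfl⟩ := natDegree_eq_zero.1 (show p.natDegree = 0 by omega)
  refine ⟨a, b, c, d, e, hdet, C_ne_zero.1 hp0, hx, ?_, ?_⟩
  · have h9 := congrArg (algebraMap (RatFunc k) (CurveField g)) hp
    rw [algebraMap_algebraMap_eq_aeval, aeval_C, map_mul, map_pow] at h9
    rw [hAB, hA, map_zero, zero_add, hWw]
    linear_combination yGen g * h9
  · rw [← h6, map_pow]

/-- The formulas define a homomorphism because the image of X is transcendental; inverting them
recovers X and Y, which gives surjectivity. -/
theorem exists_algEquiv_isGivenBy {f g : k[X]} [hf : Fact (IsGenusTwoSextic f)]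
    [hg : Fact (IsGenusTwoSextic g)] {a b c d e : k} (hdet : a * d - b * c ≠ 0) (he : e ≠ 0)
    (h : moebius 6 a b c d f = C (e ^ 2) * g) :
    ∃ σ : CurveField f ≃ₐ[k] CurveField g, IsGivenBy σ a b c d e := by
  have hW := linear_xGen_ne_zero g hdet
  set u : CurveField g := (algebraMap k (CurveField g) a * xGen g + algebraMap k (CurveField g) b) /
    (algebraMap k (CurveField g) c * xGen g + algebraMap k (CurveField g) d) with hu
  set v : CurveField g := algebraMap k (CurveField g) e * yGen g /
    (algebraMap k (CurveField g) c * xGen g + algebraMap k (CurveField g) d) ^ 3 with hv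
  have hux : u * (algebraMap k (CurveField g) c * xGen g + algebraMap k (CurveField g) d) =
      algebraMap k (CurveField g) a * xGen g + algebraMap k (CurveField g) b :=
    div_mul_cancel₀ _ hW
  have hvy : v * (algebraMap k (CurveField g) c * xGen g + algebraMap k (CurveField g) d) ^ 3 =
      algebraMap k (CurveField g) e * yGen g := div_mul_cancel₀ _ (pow_ne_zero 3 hW)
  have he' : algebraMap k (CurveField g) e ≠ 0 := by simpa using he
  have hdet' : algebraMap k (CurveField g) a * algebraMap k (CurveField g) d -
      algebraMap k (CurveField g) b * algebraMap k (CurveField g) c ≠ 0 := by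
    rw [← map_mul, ← map_mul, ← map_sub]
    exact (_root_.map_ne_zero _).2 hdet
  have hden : algebraMap k (CurveField g) a - algebraMap k (CurveField g) c * u ≠ 0 := by
    intro h0
    apply hdet'
    have h1 : (algebraMap k (CurveField g) c * u - algebraMap k (CurveField g) a) * xGen g =
        algebraMap k (CurveField g) b - algebraMap k (CurveField g) d * u := by
      linear_combination hux
    have h2 : algebraMap k (CurveField g) b - algebraMap k (CurveField g) d * u = 0 := by
      rw [← h1]
      linear_combination -xGen g * h0
    linear_combination algebraMap k (CurveField g) d * h0 - algebraMap k (CurveField g) c * h2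
  have hxu : xGen g = (algebraMap k (CurveField g) d * u - algebraMap k (CurveField g) b) /
      (algebraMap k (CurveField g) a - algebraMap k (CurveField g) c * u) := by
    rw [eq_div_iff hden]
    linear_combination -hux
  have hyv : yGen g = v * (algebraMap k (CurveField g) c * xGen g +
      algebraMap k (CurveField g) d) ^ 3 / algebraMap k (CurveField g) e := by
    rw [eq_div_iff he', hvy]
    ring
  have hinj : Function.Injective (aeval u : k[X] →ₐ[k] CurveField g) := by
    rw [← transcendental_iff_injective]
    intro halg
    have htr : Transcendental k (xGen g) :=
      transcendental_iff_injective.2 (aeval_xGen_injective g)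
    apply htr
    rw [hxu]
    have hC : ∀ z : k, IsAlgebraic k (algebraMap k (CurveField g) z) := fun z =>
      isAlgebraic_algebraMap z
    rw [div_eq_mul_inv]
    exact (((hC d).mul halg).sub (hC b)).mul ((hC a).sub ((hC c).mul halg)).inv
  have hvu : v ^ 2 = aeval u f := by
    have h1 := aeval_moebius a b c d hf.out.le_six hW
    rw [h, map_mul, aeval_C, ← yGen_sq, ← hu] at h1
    apply mul_left_cancel₀ (pow_ne_zero 6 hW)
    rw [← h1, map_pow]
    linear_combination (v * (algebraMap k (CurveField g) c * xGen g +
      algebraMap k (CurveField g) d) ^ 3 + algebraMap k (CurveField g) e * yGen g) * hvy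
  obtain ⟨φ, hφx, hφy⟩ := exists_curveField_algHom f u v hinj hvu
  have htop : φ.fieldRange = ⊤ := by
    have hum : u ∈ φ.fieldRange := ⟨xGen f, hφx⟩
    have hvm : v ∈ φ.fieldRange := ⟨yGen f, hφy⟩
    have hC : ∀ z : k, algebraMap k (CurveField g) z ∈ φ.fieldRange := fun z =>
      φ.fieldRange.algebraMap_mem z
    have hxm : xGen g ∈ φ.fieldRange := by
      rw [hxu]
      exact div_mem (sub_mem (mul_mem (hC _) hum) (hC _)) (sub_mem (hC _) (mul_mem (hC _) hum))
    refine intermediateField_eq_top_of_mem g hxm ?_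
    rw [hyv]
    exact div_mem (mul_mem hvm (pow_mem (add_mem (mul_mem (hC _) hxm) (hC _)) 3)) (hC _)
  have hbij : Function.Bijective φ := by
    refine ⟨φ.toRingHom.injective, fun z => ?_⟩
    have : z ∈ φ.fieldRange := htop ▸ trivial
    exact this
  refine ⟨AlgEquiv.ofBijective φ hbij, hdet, he, ?_, ?_, h⟩
  · rw [AlgEquiv.coe_ofBijective, hφx, hux]
  · rw [AlgEquiv.coe_ofBijective, hφy, hvy]

end Isomorphisms

/-! ### Automorphisms as matrices, and the hyperelliptic involution -/

section Automorphisms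

variable {k : Type*} [Field k]

theorem curveField_algEquiv_ext {f g : k[X]} [Fact (IsGenusTwoSextic f)]
    [Fact (IsGenusTwoSextic g)] {σ τ : CurveField f ≃ₐ[k] CurveField g}
    (hx : σ (xGen f) = τ (xGen f)) (hy : σ (yGen f) = τ (yGen f)) : σ = τ := by
  have h := curveField_algHom_ext f (φ := σ.toAlgHom) (ψ := τ.toAlgHom) hx hy
  exact AlgEquiv.ext fun z => DFunLike.congr_fun h z

theorem IsGivenBy.trans {f g h : k[X]} [hf : Fact (IsGenusTwoSextic f)]
    [Fact (IsGenusTwoSextic g)] [Fact (IsGenusTwoSextic h)]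
    {σ : CurveField f ≃ₐ[k] CurveField g} {τ : CurveField g ≃ₐ[k] CurveField h}
    {a b c d e a' b' c' d' e' : k} (hσ : IsGivenBy σ a b c d e) (hτ : IsGivenBy τ a' b' c' d' e') :
    IsGivenBy (σ.trans τ) (a * a' + b * c') (a * b' + b * d') (c * a' + d * c') (c * b' + d * d')
      (e * e') := by
  have hW := linear_xGen_ne_zero h hτ.det_ne_zero
  have hx := congrArg τ hσ.map_xGen
  have hy := congrArg τ hσ.map_yGen
  have hx' := hτ.map_xGen
  have hy' := hτ.map_yGen
  simp only [map_mul, map_add, map_pow, AlgEquiv.commutes] at hx hy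
  have hw : algebraMap k (CurveField h) (c * a' + d * c') * xGen h +
      algebraMap k (CurveField h) (c * b' + d * d') =
      (algebraMap k (CurveField h) c * τ (xGen g) + algebraMap k (CurveField h) d) *
      (algebraMap k (CurveField h) c' * xGen h + algebraMap k (CurveField h) d') := by
    simp only [map_mul, map_add]
    linear_combination -algebraMap k (CurveField h) c * hx'
  refine ⟨?_, mul_ne_zero hσ.scale_ne_zero hτ.scale_ne_zero, ?_, ?_, ?_⟩
  · convert mul_ne_zero hσ.det_ne_zero hτ.det_ne_zero using 1
    ring
  · rw [hw, AlgEquiv.trans_apply]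
    simp only [map_mul, map_add]
    linear_combination (algebraMap k (CurveField h) c' * xGen h + algebraMap k (CurveField h) d') *
      hx + algebraMap k (CurveField h) a * hx'
  · rw [hw, AlgEquiv.trans_apply]
    simp only [map_mul]
    linear_combination (algebraMap k (CurveField h) c' * xGen h +
      algebraMap k (CurveField h) d') ^ 3 * hy + algebraMap k (CurveField h) e * hy'
  · rw [← moebius_moebius _ _ _ _ _ _ _ _ hf.out.le_six hσ.det_ne_zero hτ.det_ne_zero,
      hσ.moebius_eq, moebius_C_mul, hτ.moebius_eq, mul_pow, map_mul, mul_assoc]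

/-- Substitutions compose contravariantly: τ * σ has the matrix of σ times the matrix of τ. -/
theorem IsGivenBy.mul {f : k[X]} [Fact (IsGenusTwoSextic f)] {σ τ : CurveAut f}
    {a b c d e a' b' c' d' e' : k} (hσ : IsGivenBy σ a b c d e) (hτ : IsGivenBy τ a' b' c' d' e') :
    IsGivenBy (τ * σ) (a * a' + b * c') (a * b' + b * d') (c * a' + d * c') (c * b' + d * d')
      (e * e') :=
  hσ.trans hτ

theorem IsGivenBy.map_xGen_eq_self_iff {f : k[X]} [Fact (IsGenusTwoSextic f)] {σ : CurveAut f}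
    {a b c d e : k} (hσ : IsGivenBy σ a b c d e) :
    σ (xGen f) = xGen f ↔ b = 0 ∧ c = 0 ∧ a = d := by
  constructor
  · intro h
    have h1 := hσ.map_xGen
    rw [h] at h1
    have h2 : aeval (xGen f) (C c * X ^ 2 + C (d - a) * X - C b) = aeval (xGen f) (0 : k[X]) := by
      simp only [map_add, map_sub, map_mul, map_pow, aeval_C, aeval_X, map_zero]
      linear_combination h1
    have h3 := aeval_xGen_injective f h2
    have e0 := congrArg (coeff · 0) h3
    have e1 := congrArg (coeff · 1) h3
    have e2 := congrArg (coeff · 2) h3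
    simp [coeff_X, coeff_C, -map_sub] at e0 e1 e2
    exact ⟨e0, e2, (sub_eq_zero.1 e1).symm⟩
  · rintro ⟨rfl, rfl, rfl⟩
    have hW := linear_xGen_ne_zero f hσ.det_ne_zero
    have h1 := hσ.map_xGen
    apply mul_right_cancel₀ hW
    rw [h1]
    simp only [map_zero]
    ring

theorem exists_hyperelliptic (f : k[X]) [hf : Fact (IsGenusTwoSextic f)] :
    ∃ ι : CurveAut f, ι (xGen f) = xGen f ∧ ι (yGen f) = -yGen f := by
  obtain ⟨ι, hι⟩ := exists_algEquiv_isGivenBy (f := f) (g := f) (a := 1) (b := 0) (c := 0) (d := 1)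
    (e := -1) (by simp) (by simp) (by rw [moebius_scalar one_ne_zero hf.out.le_six]; simp)
  refine ⟨ι, ?_, ?_⟩
  · simpa using hι.map_xGen
  · simpa using hι.map_yGen

/-- The hyperelliptic involution `X ↦ X`, `Y ↦ -Y`. -/
def hyperelliptic (f : k[X]) [Fact (IsGenusTwoSextic f)] : CurveAut f :=
  (exists_hyperelliptic f).choose

theorem hyperelliptic_xGen (f : k[X]) [Fact (IsGenusTwoSextic f)] :
    hyperelliptic f (xGen f) = xGen f := (exists_hyperelliptic f).choose_spec.1

theorem hyperelliptic_yGen (f : k[X]) [Fact (IsGenusTwoSextic f)] :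
    hyperelliptic f (yGen f) = -yGen f := (exists_hyperelliptic f).choose_spec.2

theorem hyperelliptic_mul_self (f : k[X]) [Fact (IsGenusTwoSextic f)] :
    hyperelliptic f * hyperelliptic f = 1 := by
  apply curveField_algEquiv_ext
  · rw [AlgEquiv.mul_apply, hyperelliptic_xGen, hyperelliptic_xGen, AlgEquiv.one_apply]
  · rw [AlgEquiv.mul_apply, hyperelliptic_yGen, map_neg, hyperelliptic_yGen, neg_neg,
      AlgEquiv.one_apply]

theorem eq_one_or_hyperelliptic {f : k[X]} [Fact (IsGenusTwoSextic f)] {σ : CurveAut f}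
    (h : σ (xGen f) = xGen f) : σ = 1 ∨ σ = hyperelliptic f := by
  have h1 := congrArg σ (yGen_sq f)
  rw [map_pow, ← aeval_algHom_apply, h, ← yGen_sq, sq_eq_sq_iff_eq_or_eq_neg] at h1
  refine h1.imp (fun h2 => ?_) (fun h2 => ?_)
  · exact curveField_algEquiv_ext h h2
  · exact curveField_algEquiv_ext (h.trans (hyperelliptic_xGen f).symm)
      (h2.trans (hyperelliptic_yGen f).symm)

theorem pow_four_eq_one {f : k[X]} (φ : CurveAut f ≃* DihedralGroup 4) (σ : CurveAut f) : σ ^ 4 = 1 := by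
  apply φ.injective
  rw [map_pow, map_one]
  generalize φ σ = z
  revert z
  decide

theorem exists_order_three {f : k[X]} (φ : CurveAut f ≃* DihedralGroup 6) :
    ∃ σ : CurveAut f, σ * σ * σ = 1 ∧ σ ≠ 1 := by
  refine ⟨φ.symm (DihedralGroup.r 2), φ.injective ?_, ?_⟩
  · simp only [map_mul, φ.apply_symm_apply, map_one]
    decide
  · rw [Ne, MulEquiv.map_eq_one_iff]
    decide

variable [CharZero k]

theorem hyperelliptic_ne_one (f : k[X]) [Fact (IsGenusTwoSextic f)] : hyperelliptic f ≠ 1 := by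
  intro h
  have h1 := hyperelliptic_yGen f
  rw [h, AlgEquiv.one_apply] at h1
  have : CharZero (CurveField f) := charZero_of_injective_algebraMap
    (algebraMap k (CurveField f)).injective
  exact yGen_ne_zero f (self_eq_neg.1 h1)

theorem hyperelliptic_mul_comm (f : k[X]) [Fact (IsGenusTwoSextic f)] (σ : CurveAut f) :
    σ * hyperelliptic f = hyperelliptic f * σ := by
  obtain ⟨a, b, c, d, e, hσ⟩ := exists_isGivenBy σ
  have hW := linear_xGen_ne_zero f hσ.det_ne_zero
  have hx := congrArg (hyperelliptic f) hσ.map_xGen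
  have hy := congrArg (hyperelliptic f) hσ.map_yGen
  simp only [map_mul, map_add, map_pow, AlgEquiv.commutes, hyperelliptic_xGen,
    hyperelliptic_yGen] at hx hy
  apply curveField_algEquiv_ext
  · rw [AlgEquiv.mul_apply, hyperelliptic_xGen, AlgEquiv.mul_apply]
    apply mul_right_cancel₀ hW
    rw [hx, hσ.map_xGen]
  · rw [AlgEquiv.mul_apply, hyperelliptic_yGen, AlgEquiv.mul_apply]
    apply mul_right_cancel₀ (pow_ne_zero 3 hW)
    rw [hy, map_neg, neg_mul, hσ.map_yGen, mul_neg]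

section Dihedral

variable {f : k[X]} [Fact (IsGenusTwoSextic f)]

/-- The hyperelliptic involution is central and nontrivial, so a group with a single nontrivial
central element identifies its image. -/
theorem map_hyperelliptic_of_center {G : Type*} [Group G] (φ : CurveAut f ≃* G) {z : G}
    (hz : ∀ x : G, x ≠ 1 → (∀ y : G, y * x = x * y) → x = z) : φ (hyperelliptic f) = z := by
  apply hz
  · simpa using hyperelliptic_ne_one f
  · intro y
    have h := congrArg φ (hyperelliptic_mul_comm f (φ.symm y))
    simpa using h

theorem map_hyperelliptic_dihedral_four (φ : CurveAut f ≃* DihedralGroup 4) :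
    φ (hyperelliptic f) = DihedralGroup.r 2 :=
  map_hyperelliptic_of_center φ (by decide)

theorem map_hyperelliptic_dihedral_six (φ : CurveAut f ≃* DihedralGroup 6) :
    φ (hyperelliptic f) = DihedralGroup.r 3 :=
  map_hyperelliptic_of_center φ (by decide)

theorem exists_sq_eq_hyperelliptic (φ : CurveAut f ≃* DihedralGroup 4) :
    ∃ σ : CurveAut f, σ * σ = hyperelliptic f := by
  refine ⟨φ.symm (DihedralGroup.r 1), φ.injective ?_⟩
  rw [map_mul, φ.apply_symm_apply, map_hyperelliptic_dihedral_four]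
  decide

theorem sq_or_cube_of_dihedral_six (φ : CurveAut f ≃* DihedralGroup 6) (σ : CurveAut f) :
    σ * σ = 1 ∨ σ * σ * σ = 1 ∨ σ * σ * σ = hyperelliptic f := by
  simp only [← φ.injective.eq_iff, map_mul, map_one, map_hyperelliptic_dihedral_six]
  generalize φ σ = z
  revert z
  decide

theorem mul_self_ne_hyperelliptic (φ : CurveAut f ≃* DihedralGroup 6) (σ : CurveAut f) :
    σ * σ ≠ hyperelliptic f := by
  rw [Ne, ← φ.injective.eq_iff, map_mul, map_hyperelliptic_dihedral_six]
  generalize φ σ = z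
  revert z
  decide

end Dihedral

end Automorphisms

/-! ### Covariance of J₂, J₄, J₆ under linear substitutions -/

section Invariants

/-- The invariant `J2` as a polynomial in the coefficients. -/
def formJ2 {R : Type*} [CommRing R] (a : ℕ → R) : R :=
  40 * a 1 * a 5 - 240 * a 0 * a 6 - 16 * a 2 * a 4 + 6 * a 3 ^ 2

/-- The invariant `J4` as a polynomial in the coefficients. -/
def formJ4 {R : Type*} [CommRing R] (a : ℕ → R) : R :=
  1620 * a 0 ^ 2 * a 6 ^ 2 - 540 * a 0 * a 1 * a 5 * a 6 - 504 * a 0 * a 2 * a 4 * a 6 +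
  300 * a 0 * a 2 * a 5 ^ 2 + 324 * a 0 * a 3 ^ 2 * a 6 - 180 * a 0 * a 3 * a 4 * a 5 +
  48 * a 0 * a 4 ^ 3 + 300 * a 1 ^ 2 * a 4 * a 6 - 80 * a 1 ^ 2 * a 5 ^ 2 -
  180 * a 1 * a 2 * a 3 * a 6 + 4 * a 1 * a 2 * a 4 * a 5 + 36 * a 1 * a 3 ^ 2 * a 5 -
  12 * a 1 * a 3 * a 4 ^ 2 + 48 * a 2 ^ 3 * a 6 - 12 * a 2 ^ 2 * a 3 * a 5 +
  4 * a 2 ^ 2 * a 4 ^ 2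

/-- The invariant `J6` as a polynomial in the coefficients. -/
def formJ6 {R : Type*} [CommRing R] (a : ℕ → R) : R :=
  59940 * a 0 ^ 2 * a 1 * a 5 * a 6 ^ 2 - 119880 * a 0 ^ 3 * a 6 ^ 3 +
  20664 * a 0 ^ 2 * a 2 * a 4 * a 6 ^ 2 - 18600 * a 0 ^ 2 * a 2 * a 5 ^ 2 * a 6 -
  10044 * a 0 ^ 2 * a 3 ^ 2 * a 6 ^ 2 + 3060 * a 0 ^ 2 * a 3 * a 4 * a 5 * a 6 +
  2250 * a 0 ^ 2 * a 3 * a 5 ^ 3 - 96 * a 0 ^ 2 * a 4 ^ 3 * a 6 -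
  900 * a 0 ^ 2 * a 4 ^ 2 * a 5 ^ 2 - 18600 * a 0 * a 1 ^ 2 * a 4 * a 6 ^ 2 -
  2240 * a 0 * a 1 ^ 2 * a 5 ^ 2 * a 6 + 3060 * a 0 * a 1 * a 2 * a 3 * a 6 ^ 2 +
  3472 * a 0 * a 1 * a 2 * a 4 * a 5 * a 6 + 1600 * a 0 * a 1 * a 2 * a 5 ^ 3 +
  1818 * a 0 * a 1 * a 3 ^ 2 * a 5 * a 6 - 876 * a 0 * a 1 * a 3 * a 4 ^ 2 * a 6 -
  1860 * a 0 * a 1 * a 3 * a 4 * a 5 ^ 2 + 616 * a 0 * a 1 * a 4 ^ 3 * a 5 -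
  96 * a 0 * a 2 ^ 3 * a 6 ^ 2 - 876 * a 0 * a 2 ^ 2 * a 3 * a 5 * a 6 +
  424 * a 0 * a 2 ^ 2 * a 4 ^ 2 * a 6 - 640 * a 0 * a 2 ^ 2 * a 4 * a 5 ^ 2 -
  468 * a 0 * a 2 * a 3 ^ 2 * a 4 * a 6 + 330 * a 0 * a 2 * a 3 ^ 2 * a 5 ^ 2 +
  492 * a 0 * a 2 * a 3 * a 4 ^ 2 * a 5 - 160 * a 0 * a 2 * a 4 ^ 4 +
  162 * a 0 * a 3 ^ 4 * a 6 - 198 * a 0 * a 3 ^ 3 * a 4 * a 5 +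
  60 * a 0 * a 3 ^ 2 * a 4 ^ 3 + 2250 * a 1 ^ 3 * a 3 * a 6 ^ 2 +
  1600 * a 1 ^ 3 * a 4 * a 5 * a 6 - 320 * a 1 ^ 3 * a 5 ^ 3 -
  900 * a 1 ^ 2 * a 2 ^ 2 * a 6 ^ 2 - 1860 * a 1 ^ 2 * a 2 * a 3 * a 5 * a 6 -
  640 * a 1 ^ 2 * a 2 * a 4 ^ 2 * a 6 + 64 * a 1 ^ 2 * a 2 * a 4 * a 5 ^ 2 +
  330 * a 1 ^ 2 * a 3 ^ 2 * a 4 * a 6 + 176 * a 1 ^ 2 * a 3 ^ 2 * a 5 ^ 2 +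
  26 * a 1 ^ 2 * a 3 * a 4 ^ 2 * a 5 - 36 * a 1 ^ 2 * a 4 ^ 4 +
  616 * a 1 * a 2 ^ 3 * a 5 * a 6 + 492 * a 1 * a 2 ^ 2 * a 3 * a 4 * a 6 +
  26 * a 1 * a 2 ^ 2 * a 3 * a 5 ^ 2 + 28 * a 1 * a 2 ^ 2 * a 4 ^ 2 * a 5 -
  198 * a 1 * a 2 * a 3 ^ 3 * a 6 - 238 * a 1 * a 2 * a 3 ^ 2 * a 4 * a 5 +
  76 * a 1 * a 2 * a 3 * a 4 ^ 3 + 72 * a 1 * a 3 ^ 4 * a 5 - 24 * a 1 * a 3 ^ 3 * a 4 ^ 2 -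
  160 * a 2 ^ 4 * a 4 * a 6 - 36 * a 2 ^ 4 * a 5 ^ 2 + 60 * a 2 ^ 3 * a 3 ^ 2 * a 6 +
  76 * a 2 ^ 3 * a 3 * a 4 * a 5 - 24 * a 2 ^ 3 * a 4 ^ 3 - 24 * a 2 ^ 2 * a 3 ^ 3 * a 5 +
  8 * a 2 ^ 2 * a 3 ^ 2 * a 4 ^ 2

theorem J2_eq {k : Type*} [Field k] (f : k[X]) : J2 f = formJ2 f.coeff := rfl

theorem J4_eq {k : Type*} [Field k] (f : k[X]) : J4 f = formJ4 f.coeff := rfl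

theorem J6_eq {k : Type*} [Field k] (f : k[X]) : J6 f = formJ6 f.coeff := rfl

/-- Infinitesimal invariance under translation: the hypotheses are those satisfied by the Hasse
derivatives of a sextic, the Taylor coefficients at a moving point. -/
theorem derivative_formJ2 {R : Type*} [CommRing R] (A : ℕ → R[X])
    (h0 : derivative (A 0) = A 1) (h1 : derivative (A 1) = 2 * A 2)
    (h2 : derivative (A 2) = 3 * A 3) (h3 : derivative (A 3) = 4 * A 4)
    (h4 : derivative (A 4) = 5 * A 5) (h5 : derivative (A 5) = 6 * A 6)
    (h6 : derivative (A 6) = 0) : derivative (formJ2 A) = 0 := by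
  simp only [formJ2, derivative_add, derivative_sub, derivative_mul, derivative_pow,
    derivative_ofNat, h0, h1, h2, h3, h4, h5, h6, Nat.cast_ofNat, map_ofNat]
  ring

theorem derivative_formJ4 {R : Type*} [CommRing R] (A : ℕ → R[X])
    (h0 : derivative (A 0) = A 1) (h1 : derivative (A 1) = 2 * A 2)
    (h2 : derivative (A 2) = 3 * A 3) (h3 : derivative (A 3) = 4 * A 4)
    (h4 : derivative (A 4) = 5 * A 5) (h5 : derivative (A 5) = 6 * A 6)
    (h6 : derivative (A 6) = 0) : derivative (formJ4 A) = 0 := by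
  simp only [formJ4, derivative_add, derivative_sub, derivative_mul, derivative_pow,
    derivative_ofNat, h0, h1, h2, h3, h4, h5, h6, Nat.cast_ofNat, map_ofNat]
  ring

set_option maxHeartbeats 2000000 in
theorem derivative_formJ6 {R : Type*} [CommRing R] (A : ℕ → R[X])
    (h0 : derivative (A 0) = A 1) (h1 : derivative (A 1) = 2 * A 2)
    (h2 : derivative (A 2) = 3 * A 3) (h3 : derivative (A 3) = 4 * A 4)
    (h4 : derivative (A 4) = 5 * A 5) (h5 : derivative (A 5) = 6 * A 6)
    (h6 : derivative (A 6) = 0) : derivative (formJ6 A) = 0 := by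
  simp only [formJ6, derivative_add, derivative_sub, derivative_mul, derivative_pow,
    derivative_ofNat, h0, h1, h2, h3, h4, h5, h6, Nat.cast_ofNat, map_ofNat]
  ring

variable {k : Type*} [Field k]

theorem derivative_hasseDeriv (f : k[X]) (i : ℕ) :
    derivative (hasseDeriv i f) = (i + 1 : k[X]) * hasseDeriv (i + 1) f := by
  have h := LinearMap.congr_fun (hasseDeriv_comp (R := k) 1 i) f
  rw [LinearMap.comp_apply, hasseDeriv_one, add_comm, Nat.choose_one_right] at h
  rw [h, LinearMap.smul_apply, nsmul_eq_mul]
  push_cast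
  rfl

theorem moebius_translation {f : k[X]} (hf : f.natDegree ≤ 6) (s : k) :
    moebius 6 1 s 0 1 f = taylor s f := by
  rw [taylor_apply, comp, eval₂_eq_sum_range' _ (Nat.lt_succ_of_le hf), moebius]
  simp

theorem eval_eq_of_derivative_eq_zero [CharZero k] {p : k[X]} (h : derivative p = 0) (s : k) :
    p.eval s = p.eval 0 := by
  obtain ⟨c, rfl⟩ := natDegree_eq_zero.1 (derivative_eq_zero.1 h)
  simp

/-- As a function of the base point s, the invariant of the translated sextic is a polynomial with
zero derivative, hence constant in characteristic 0. -/
theorem form_taylor [CharZero k] {F : (ℕ → k) → k} {F' : (ℕ → k[X]) → k[X]}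
    (hev : ∀ (A : ℕ → k[X]) (s : k), (F' A).eval s = F fun i => (A i).eval s)
    (hder : ∀ A : ℕ → k[X], derivative (A 0) = A 1 → derivative (A 1) = 2 * A 2 →
      derivative (A 2) = 3 * A 3 → derivative (A 3) = 4 * A 4 → derivative (A 4) = 5 * A 5 →
      derivative (A 5) = 6 * A 6 → derivative (A 6) = 0 → derivative (F' A) = 0)
    {f : k[X]} (hf : f.natDegree ≤ 6) (s : k) : F (taylor s f).coeff = F f.coeff := by
  have h := eval_eq_of_derivative_eq_zero (hder (fun i => hasseDeriv i f) ?_ ?_ ?_ ?_ ?_ ?_ ?_) s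
  · rw [hev, hev] at h
    simp only [← taylor_coeff] at h
    rw [taylor_zero] at h
    exact h
  all_goals
    rw [derivative_hasseDeriv]
    try norm_num
  exact hasseDeriv_eq_zero_of_lt_natDegree f 7 (by omega)

theorem coeff_moebius_diagonal (f : k[X]) (p q : k) {i : ℕ} (hi : i ≤ 6) :
    (moebius 6 p 0 0 q f).coeff i = f.coeff i * (p ^ i * q ^ (6 - i)) := by
  have h : ∀ j, C (f.coeff j) * (C p * X + C 0) ^ j * (C 0 * X + C q) ^ (6 - j) =
      C (f.coeff j * (p ^ j * q ^ (6 - j))) * X ^ j := by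
    intro j
    simp only [map_zero, zero_mul, zero_add, add_zero, map_mul, map_pow]
    ring
  rw [moebius, finsetSum_coeff, Finset.sum_eq_single i]
  · rw [h, coeff_C_mul_X_pow, if_pos rfl]
  · intro j _ hj
    rw [h, coeff_C_mul_X_pow, if_neg hj.symm]
  · intro h
    exact absurd (Finset.mem_range.2 (by omega)) h

theorem coeff_moebius_inversion (f : k[X]) {i : ℕ} (hi : i ≤ 6) :
    (moebius 6 0 1 1 0 f).coeff i = f.coeff (6 - i) := by
  have h : ∀ j, C (f.coeff j) * (C (0 : k) * X + C 1) ^ j * (C 1 * X + C 0) ^ (6 - j) =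
      C (f.coeff j) * X ^ (6 - j) := by
    intro j
    simp
  rw [moebius, finsetSum_coeff, Finset.sum_eq_single (6 - i)]
  · rw [h, coeff_C_mul_X_pow, if_pos (by omega)]
  · intro j hj hji
    have := Finset.mem_range.1 hj
    rw [h, coeff_C_mul_X_pow, if_neg (by omega)]
  · intro h
    exact absurd (Finset.mem_range.2 (by omega)) h

/-- Translations, diagonal matrices and the inversion generate GL₂. The inversion has determinant
−1, which is harmless for even w. -/
theorem invariant_moebius {F : k[X] → k} {w : ℕ} (hw : Even w)
    (htr : ∀ f : k[X], f.natDegree ≤ 6 → ∀ s, F (moebius 6 1 s 0 1 f) = F f)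
    (hdg : ∀ (f : k[X]) (p q : k), F (moebius 6 p 0 0 q f) = (p * q) ^ w * F f)
    (hin : ∀ f : k[X], F (moebius 6 0 1 1 0 f) = F f)
    {f : k[X]} (hf : f.natDegree ≤ 6) {a b c d : k} (h : a * d - b * c ≠ 0) :
    F (moebius 6 a b c d f) = (a * d - b * c) ^ w * F f := by
  have hup : ∀ f : k[X], f.natDegree ≤ 6 → ∀ a b d : k, a * d ≠ 0 →
      F (moebius 6 a b 0 d f) = (a * d) ^ w * F f := by
    intro f hf a b d had
    have ha : a ≠ 0 := left_ne_zero_of_mul had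
    have h1 := moebius_moebius a 0 0 d 1 (b / a) 0 1 hf (by simpa using had) (by simp)
    have h2 : moebius 6 a b 0 d f = moebius 6 1 (b / a) 0 1 (moebius 6 a 0 0 d f) := by
      rw [h1]
      congr 1 <;> field_simp <;> ring
    rw [h2, htr _ (natDegree_moebius_le _ _ _ _ _ _), hdg]
  by_cases hc : c = 0
  · subst hc
    rw [mul_zero, sub_zero] at h ⊢
    exact hup f hf a b d h
  · have hD : b - a * d / c ≠ 0 := by
      intro h0
      apply h
      have : b = a * d / c := sub_eq_zero.1 h0
      rw [this]
      field_simp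
      ring
    have h1 := moebius_moebius (b - a * d / c) (a / c) 0 1 0 1 1 0 hf
      (by simpa using hD) (by simp)
    have h2 := moebius_moebius (n := 6) (a / c) (b - a * d / c) 1 0 c d 0 1 hf
      (by rw [mul_zero, zero_sub, mul_one]; exact neg_ne_zero.2 hD) (by simpa using hc)
    -- Bruhat decomposition for c ≠ 0: upper triangular, inversion, upper triangular.
    have h3 : moebius 6 a b c d f =
        moebius 6 c d 0 1 (moebius 6 0 1 1 0 (moebius 6 (b - a * d / c) (a / c) 0 1 f)) := by
      rw [h1]
      simp only [mul_zero, mul_one, zero_add, add_zero]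
      rw [h2]
      congr 1 <;> field_simp <;> ring
    rw [h3, hup _ (natDegree_moebius_le _ _ _ _ _ _) c d 1 (by simpa using hc), hin,
      hup f hf _ _ _ (by simpa using hD), ← mul_assoc, ← mul_pow, ← hw.neg_pow]
    congr 2
    field_simp
    ring

theorem J2_moebius [CharZero k] {f : k[X]} (hf : f.natDegree ≤ 6) {a b c d : k}
    (h : a * d - b * c ≠ 0) : J2 (moebius 6 a b c d f) = (a * d - b * c) ^ 6 * J2 f := by
  refine invariant_moebius (by decide) (fun f hf s => ?_) (fun f p q => ?_) (fun f => ?_) hf h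
  · rw [moebius_translation hf, J2_eq, J2_eq]
    refine form_taylor (F := formJ2) (F' := formJ2) (fun A s => ?_) derivative_formJ2 hf s
    simp [formJ2]
  · simp only [J2_eq, formJ2]
    simp only [coeff_moebius_diagonal, Nat.reduceLeDiff]
    ring
  · simp only [J2_eq, formJ2]
    simp only [coeff_moebius_inversion, Nat.reduceLeDiff, Nat.reduceSub]
    ring

theorem J4_moebius [CharZero k] {f : k[X]} (hf : f.natDegree ≤ 6) {a b c d : k}
    (h : a * d - b * c ≠ 0) : J4 (moebius 6 a b c d f) = (a * d - b * c) ^ 12 * J4 f := by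
  refine invariant_moebius (by decide) (fun f hf s => ?_) (fun f p q => ?_) (fun f => ?_) hf h
  · rw [moebius_translation hf, J4_eq, J4_eq]
    refine form_taylor (F := formJ4) (F' := formJ4) (fun A s => ?_) derivative_formJ4 hf s
    simp [formJ4]
  · simp only [J4_eq, formJ4]
    simp only [coeff_moebius_diagonal, Nat.reduceLeDiff]
    ring
  · simp only [J4_eq, formJ4]
    simp only [coeff_moebius_inversion, Nat.reduceLeDiff, Nat.reduceSub]
    ring

theorem J6_moebius [CharZero k] {f : k[X]} (hf : f.natDegree ≤ 6) {a b c d : k}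
    (h : a * d - b * c ≠ 0) : J6 (moebius 6 a b c d f) = (a * d - b * c) ^ 18 * J6 f := by
  refine invariant_moebius (by decide) (fun f hf s => ?_) (fun f p q => ?_) (fun f => ?_) hf h
  · rw [moebius_translation hf, J6_eq, J6_eq]
    refine form_taylor (F := formJ6) (F' := formJ6) (fun A s => ?_) derivative_formJ6 hf s
    simp [formJ6]
  · simp only [J6_eq, formJ6]
    simp only [coeff_moebius_diagonal, Nat.reduceLeDiff]
    ring
  · simp only [J6_eq, formJ6]
    simp only [coeff_moebius_inversion, Nat.reduceLeDiff, Nat.reduceSub]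
    ring

theorem J2_C_mul (e : k) (f : k[X]) : J2 (C e * f) = e ^ 2 * J2 f := by
  simp only [J2_eq, formJ2, coeff_C_mul]
  ring

theorem J4_C_mul (e : k) (f : k[X]) : J4 (C e * f) = e ^ 4 * J4 f := by
  simp only [J4_eq, formJ4, coeff_C_mul]
  ring

theorem J6_C_mul (e : k) (f : k[X]) : J6 (C e * f) = e ^ 6 * J6 f := by
  simp only [J6_eq, formJ6, coeff_C_mul]
  ring

theorem invariants_eq_of_curveIso [CharZero k] {f g : k[X]} (hf : IsGenusTwoSextic f)
    (hg : IsGenusTwoSextic g) (hJ : J2 f ≠ 0) (h : CurveIso f g) :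
    J2 g ≠ 0 ∧ i1 g = i1 f ∧ i2 g = i2 f := by
  have : Fact (IsGenusTwoSextic f) := ⟨hf⟩
  have : Fact (IsGenusTwoSextic g) := ⟨hg⟩
  obtain ⟨σ⟩ := h
  obtain ⟨a, b, c, d, e, hσ⟩ := exists_isGivenBy σ
  have hdet := hσ.det_ne_zero
  have he := hσ.scale_ne_zero
  have h2 := J2_moebius hf.le_six hdet
  have h4 := J4_moebius hf.le_six hdet
  have h6 := J6_moebius hf.le_six hdet
  rw [hσ.moebius_eq] at h2 h4 h6
  rw [J2_C_mul] at h2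
  rw [J4_C_mul] at h4
  rw [J6_C_mul] at h6
  generalize a * d - b * c = D at hdet h2 h4 h6
  have h2' : J2 g = D ^ 6 * J2 f / e ^ 4 := by
    rw [eq_div_iff (pow_ne_zero 4 he)]
    linear_combination h2
  have h4' : J4 g = D ^ 12 * J4 f / e ^ 8 := by
    rw [eq_div_iff (pow_ne_zero 8 he)]
    linear_combination h4
  have h6' : J6 g = D ^ 18 * J6 f / e ^ 12 := by
    rw [eq_div_iff (pow_ne_zero 12 he)]
    linear_combination h6
  refine ⟨?_, ?_, ?_⟩
  · rw [h2']
    exact div_ne_zero (mul_ne_zero (pow_ne_zero 6 hdet) hJ) (pow_ne_zero 4 he)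
  · rw [i1, i1, h2', h4']
    field_simp
  · rw [i2, i2, h2', h4', h6']
    field_simp

end Invariants

/-! ### Diagonalization and the D₈ normal form -/

section NormalForms

variable {k : Type*} [Field k]

theorem curveIso_of_moebius {f g : k[X]} (hf : IsGenusTwoSextic f) (hg : IsGenusTwoSextic g)
    {a b c d e : k} (hdet : a * d - b * c ≠ 0) (he : e ≠ 0)
    (h : moebius 6 a b c d f = C (e ^ 2) * g) : CurveIso f g := by
  have : Fact (IsGenusTwoSextic f) := ⟨hf⟩
  have : Fact (IsGenusTwoSextic g) := ⟨hg⟩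
  obtain ⟨σ, -⟩ := exists_algEquiv_isGivenBy hdet he h
  exact ⟨σ⟩

theorem CurveIso.trans {f g h : k[X]} (h₁ : CurveIso f g) (h₂ : CurveIso g h) : CurveIso f h := by
  obtain ⟨σ⟩ := h₁
  obtain ⟨τ⟩ := h₂
  exact ⟨σ.trans τ⟩

theorem CurveIso.aut_mulEquiv {f g : k[X]} (h : CurveIso f g) {G : Type*} [Group G]
    (hG : Nonempty (CurveAut f ≃* G)) : Nonempty (CurveAut g ≃* G) := by
  obtain ⟨σ⟩ := h
  obtain ⟨φ⟩ := hG
  exact ⟨(AlgEquiv.autCongr σ.symm).trans φ⟩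

theorem eq_of_coeff_eq_of_natDegree_le_six {p q : k[X]} (hp : p.natDegree ≤ 6)
    (hq : q.natDegree ≤ 6) (h0 : p.coeff 0 = q.coeff 0) (h1 : p.coeff 1 = q.coeff 1)
    (h2 : p.coeff 2 = q.coeff 2) (h3 : p.coeff 3 = q.coeff 3) (h4 : p.coeff 4 = q.coeff 4)
    (h5 : p.coeff 5 = q.coeff 5) (h6 : p.coeff 6 = q.coeff 6) : p = q := by
  ext i
  by_cases hi : i ≤ 6
  · interval_cases i <;> assumption
  · rw [coeff_eq_zero_of_natDegree_lt (by omega), coeff_eq_zero_of_natDegree_lt (by omega)]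

/-- Scalar matrices fix X and send Y to eY/d³; the sign of e/d³ separates the identity from the
hyperelliptic involution. -/
theorem IsGivenBy.scale_eq_of_one {f : k[X]} [Fact (IsGenusTwoSextic f)] {a b c d e : k}
    (h : IsGivenBy (1 : CurveAut f) a b c d e) : d ^ 3 = e := by
  obtain ⟨rfl, rfl, rfl⟩ := h.map_xGen_eq_self_iff.1 rfl
  have h1 := h.map_yGen
  rw [AlgEquiv.one_apply, map_zero, zero_mul, zero_add, mul_comm, ← map_pow] at h1
  exact (algebraMap k (CurveField f)).injective (mul_right_cancel₀ (yGen_ne_zero f) h1)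

theorem IsGivenBy.scale_eq_of_hyperelliptic {f : k[X]} [Fact (IsGenusTwoSextic f)] {a b c d e : k}
    (h : IsGivenBy (hyperelliptic f) a b c d e) : -d ^ 3 = e := by
  obtain ⟨rfl, rfl, rfl⟩ := h.map_xGen_eq_self_iff.1 (hyperelliptic_xGen f)
  have h1 := h.map_yGen
  rw [hyperelliptic_yGen, map_zero, zero_mul, zero_add, neg_mul_comm, mul_comm, ← map_pow,
    ← map_neg] at h1
  exact (algebraMap k (CurveField f)).injective (mul_right_cancel₀ (yGen_ne_zero f) h1)

theorem exists_eigenbasis [IsAlgClosed k] [CharZero k] (a b c d : k)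
    (h : (a + d) ^ 2 - 4 * (a * d - b * c) ≠ 0) :
    ∃ l m p q r s : k, l ≠ m ∧ l + m = a + d ∧ l * m = a * d - b * c ∧ p * s - q * r ≠ 0 ∧
      a * p + b * r = p * l ∧ a * q + b * s = q * m ∧ c * p + d * r = r * l ∧
      c * q + d * s = s * m := by
  by_cases hc : c = 0
  · subst hc
    have had : d - a ≠ 0 := by
      intro h0
      apply h
      linear_combination (d - a) * h0
    refine ⟨a, d, 1, b, 0, d - a, (sub_ne_zero.1 had).symm, rfl, ?_, ?_, ?_, ?_, ?_, ?_⟩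
    · ring
    · simpa using had
    all_goals ring
  · obtain ⟨δ, hδ⟩ := IsAlgClosed.exists_pow_nat_eq ((a + d) ^ 2 - 4 * (a * d - b * c)) two_pos
    have hδ0 : δ ≠ 0 := by
      rintro rfl
      exact h (by rw [← hδ]; ring)
    refine ⟨(a + d + δ) / 2, (a + d - δ) / 2, (a + d + δ) / 2 - d, (a + d - δ) / 2 - d, c, c,
      ?_, ?_, ?_, ?_, ?_, ?_, ?_, ?_⟩
    · intro h0
      apply hδ0
      linear_combination h0
    · ring
    · linear_combination -hδ / 4
    · convert mul_ne_zero hc hδ0 using 1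
      ring
    · linear_combination -hδ / 4
    · linear_combination -hδ / 4
    all_goals ring

/-- In an eigenbasis the substitution multiplies XⁱZ⁶⁻ⁱ by lⁱm⁶⁻ⁱ, so only monomials with this
factor equal to ε survive. -/
theorem exists_diagonal_form [IsAlgClosed k] [CharZero k] {f : k[X]} (hf : IsGenusTwoSextic f)
    {a b c d ε : k} (hdet : a * d - b * c ≠ 0) (hdisc : (a + d) ^ 2 - 4 * (a * d - b * c) ≠ 0)
    (h : moebius 6 a b c d f = C ε * f) :
    ∃ (l m : k) (g : k[X]), l ≠ m ∧ l + m = a + d ∧ l * m = a * d - b * c ∧ IsGenusTwoSextic g ∧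
      CurveIso f g ∧ ∀ i ≤ 6, g.coeff i * (l ^ i * m ^ (6 - i)) = ε * g.coeff i := by
  obtain ⟨l, m, p, q, r, s, hlm, hadd, hmul, hP, h1, h2, h3, h4⟩ := exists_eigenbasis a b c d hdisc
  have hg := hf.moebius hP
  refine ⟨l, m, moebius 6 p q r s f, hlm, hadd, hmul, hg,
    curveIso_of_moebius hf hg hP one_ne_zero (by simp), fun i hi => ?_⟩
  have hlm0 : l * m - 0 * 0 ≠ 0 := by
    rw [mul_zero, sub_zero, hmul]
    exact hdet
  have h5 : moebius 6 l 0 0 m (moebius 6 p q r s f) = C ε * moebius 6 p q r s f := by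
    rw [moebius_moebius _ _ _ _ _ _ _ _ hf.le_six hP hlm0, ← moebius_C_mul, ← h,
      moebius_moebius _ _ _ _ _ _ _ _ hf.le_six hdet hP, h1, h2, h3, h4]
    simp
  rw [← coeff_moebius_diagonal _ _ _ hi, h5, coeff_C_mul]

theorem not_isGenusTwoSextic_of_X_sq_dvd {f : k[X]} (h : X ^ 2 ∣ f) : ¬IsGenusTwoSextic f := by
  intro hf
  rw [sq] at h
  exact not_isUnit_X (hf.2 X h)

theorem exists_curveIso_d8Form [IsAlgClosed k] {α β γ : k} (hα : α ≠ 0) (hβ : β ≠ 0)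
    (hg : IsGenusTwoSextic (C α * X ^ 5 + C β * X ^ 3 + C γ * X)) :
    ∃ t, IsGenusTwoSextic (d8Form t) ∧
      CurveIso (C α * X ^ 5 + C β * X ^ 3 + C γ * X) (d8Form t) := by
  -- X ↦ pX with p² = β/α makes the coefficients of X⁵ and X³ equal; e² is their common value.
  obtain ⟨p, hp⟩ := IsAlgClosed.exists_pow_nat_eq (β / α) two_pos
  have hp0 : p ≠ 0 := by
    rintro rfl
    refine div_ne_zero hβ hα ?_
    rw [← hp]
    ring
  have hβp : β = α * p ^ 2 := by
    rw [hp]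
    field_simp
  obtain ⟨e, he⟩ := IsAlgClosed.exists_pow_nat_eq (α * p ^ 5) two_pos
  have hE : α * p ^ 5 ≠ 0 := mul_ne_zero hα (pow_ne_zero 5 hp0)
  have he0 : e ≠ 0 := by
    rintro rfl
    refine hE ?_
    rw [← he]
    ring
  have hmob : moebius 6 p 0 0 1 (C α * X ^ 5 + C β * X ^ 3 + C γ * X) =
      C (e ^ 2) * d8Form (γ / (α * p ^ 4)) := by
    rw [he]
    apply eq_of_coeff_eq_of_natDegree_le_six (natDegree_moebius_le _ _ _ _ _ _)
    · refine (natDegree_C_mul_le _ _).trans ?_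
      rw [d8Form]
      compute_degree
      norm_num
    all_goals
      rw [coeff_moebius_diagonal _ _ _ (by norm_num), coeff_C_mul]
      simp [coeff_X, coeff_X_pow, d8Form]
    · field_simp
    · rw [hβp]
      ring
  have hdet : p * 1 - 0 * 0 ≠ 0 := by simpa using hp0
  have ht : IsGenusTwoSextic (d8Form (γ / (α * p ^ 4))) := by
    have h1 := (hg.moebius hdet).C_mul (inv_ne_zero (pow_ne_zero 2 he0))
    rwa [hmob, ← mul_assoc, ← map_mul, inv_mul_cancel₀ (pow_ne_zero 2 he0), map_one, one_mul]
      at h1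
  exact ⟨_, ht, curveIso_of_moebius hg ht hdet he0 hmob⟩

variable [CharZero k]

/-- The matrix of σ has scalar square without being scalar, so its trace is 0 and its eigenvalues
are l and −l. Since σ² is the hyperelliptic involution and not 1, e² = −l⁶, which kills the even
coefficients. -/
theorem exists_odd_quintic [IsAlgClosed k] {f : k[X]} [hf : Fact (IsGenusTwoSextic f)]
    {σ : CurveAut f} (hσ : σ * σ = hyperelliptic f) :
    ∃ α β γ : k, α ≠ 0 ∧ IsGenusTwoSextic (C α * X ^ 5 + C β * X ^ 3 + C γ * X) ∧
      CurveIso f (C α * X ^ 5 + C β * X ^ 3 + C γ * X) := by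
  obtain ⟨a, b, c, d, e, h⟩ := exists_isGivenBy σ
  have h2 := h.mul h
  rw [hσ] at h2
  have he := h2.scale_eq_of_hyperelliptic
  obtain ⟨hb, hc, had⟩ := h2.map_xGen_eq_self_iff.1 (hyperelliptic_xGen f)
  have htr : a + d = 0 := by
    by_contra htr
    have hb0 : b = 0 := (mul_eq_zero.1 (show b * (a + d) = 0 by linear_combination hb)).resolve_right
      htr
    have hc0 : c = 0 := (mul_eq_zero.1 (show c * (a + d) = 0 by linear_combination hc)).resolve_right
      htr
    have had0 : a = d := by
      have : (a - d) * (a + d) = 0 := by linear_combination had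
      exact sub_eq_zero.1 ((mul_eq_zero.1 this).resolve_right htr)
    rcases eq_one_or_hyperelliptic (h.map_xGen_eq_self_iff.2 ⟨hb0, hc0, had0⟩) with h1 | h1
    · rw [h1, one_mul] at hσ
      exact hyperelliptic_ne_one f hσ.symm
    · rw [h1, hyperelliptic_mul_self] at hσ
      exact hyperelliptic_ne_one f hσ.symm
  have hdet := h.det_ne_zero
  obtain ⟨l, m, g, hlm, hadd, hmul, hg, hfg, hcoef⟩ := exists_diagonal_form hf.out hdet
    (by rw [htr]; simpa using hdet) h.moebius_eq
  have hm : m = -l := by linear_combination hadd + htr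
  have hl : l ≠ 0 := by
    rintro rfl
    exact hlm (by rw [hm, neg_zero])
  have he' : e ^ 2 = -l ^ 6 := by
    have h3 : c * b + d * d = l ^ 2 := by
      rw [hm] at hmul
      linear_combination hmul + d * htr
    rw [h3] at he
    linear_combination -he
  have heven : ∀ i ≤ 6, Even i → g.coeff i = 0 := by
    intro i hi hev
    have h3 := hcoef i hi
    have h4 : l ^ i * m ^ (6 - i) = l ^ 6 := by
      rw [hm, Even.neg_pow (by obtain ⟨j, hj⟩ := hev; exact ⟨3 - j, by omega⟩), ← pow_add]
      congr 1
      omega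
    rw [h4, he'] at h3
    have h5 : (2 * l ^ 6) * g.coeff i = 0 := by linear_combination h3
    exact (mul_eq_zero.1 h5).resolve_left (mul_ne_zero two_ne_zero (pow_ne_zero 6 hl))
  have c0 := heven 0 (by norm_num) (by decide)
  have c2 := heven 2 (by norm_num) (by decide)
  have c4 := heven 4 (by norm_num) (by decide)
  have c6 := heven 6 (by norm_num) (by decide)
  have hgeq : g = C (g.coeff 5) * X ^ 5 + C (g.coeff 3) * X ^ 3 + C (g.coeff 1) * X := by
    apply eq_of_coeff_eq_of_natDegree_le_six hg.le_six
    · compute_degree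
      norm_num
    all_goals simp [coeff_X, coeff_X_pow, c0, c2, c4, c6]
  refine ⟨g.coeff 5, g.coeff 3, g.coeff 1, ?_, hgeq ▸ hg, hgeq ▸ hfg⟩
  intro h5
  have hdeg := hg.five_le
  have : g.natDegree ≤ 4 := by
    rw [hgeq, h5]
    simp only [map_zero, zero_mul, zero_add]
    compute_degree
    norm_num
  omega

/-- If β = 0, then X ↦ IX, Y ↦ eY with I² = −1, e² = I is an automorphism whose fourth power sends Y
to −Y, but fourth powers are trivial in D₈. -/
theorem cubic_coeff_ne_zero_of_dihedral_four [IsAlgClosed k] {α β γ : k}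
    (hg : IsGenusTwoSextic (C α * X ^ 5 + C β * X ^ 3 + C γ * X))
    (hφ : Nonempty (CurveAut (C α * X ^ 5 + C β * X ^ 3 + C γ * X) ≃* DihedralGroup 4)) :
    β ≠ 0 := by
  rintro rfl
  obtain ⟨φ⟩ := hφ
  generalize hgeq : (C α * X ^ 5 + C 0 * X ^ 3 + C γ * X : k[X]) = g at hg φ
  have : Fact (IsGenusTwoSextic g) := ⟨hg⟩
  obtain ⟨I, hI⟩ := IsAlgClosed.exists_pow_nat_eq (-1 : k) two_pos
  obtain ⟨e, he⟩ := IsAlgClosed.exists_pow_nat_eq I two_pos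
  have hI0 : I ≠ 0 := by
    rintro rfl
    norm_num at hI
  have he0 : e ≠ 0 := by
    rintro rfl
    exact hI0 (by rw [← he]; ring)
  have hmob : moebius 6 I 0 0 1 g = C (e ^ 2) * g := by
    rw [he]
    apply eq_of_coeff_eq_of_natDegree_le_six (natDegree_moebius_le _ _ _ _ _ _)
      ((natDegree_C_mul_le _ _).trans hg.le_six)
    all_goals
      rw [coeff_moebius_diagonal _ _ _ (by norm_num), ← hgeq]
      simp [coeff_X, coeff_X_pow]
    · ring
    · linear_combination α * I * (I ^ 2 - 1) * hI
  obtain ⟨τ, hτ⟩ := exists_algEquiv_isGivenBy (f := g) (g := g) (by simpa using hI0) he0 hmob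
  have h4 := (hτ.mul hτ).mul (hτ.mul hτ)
  rw [show τ * τ * (τ * τ) = τ ^ 4 by
    simp only [pow_succ, pow_zero, one_mul, mul_assoc], pow_four_eq_one φ] at h4
  have h5 := h4.scale_eq_of_one
  have h6 : (2 : k) = 0 := by
    linear_combination h5 + (e ^ 2 + I) * he + hI
  exact two_ne_zero h6

/-- At t = 9/100 there is an automorphism acting on X with order 3, impossible in a group of order
8. -/
theorem d8Form_param_ne [IsAlgClosed k] {t : k} (ht : IsGenusTwoSextic (d8Form t))
    (hφ : Nonempty (CurveAut (d8Form t) ≃* DihedralGroup 4)) : t ≠ 9 / 100 := by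
  rintro rfl
  obtain ⟨φ⟩ := hφ
  have : Fact (IsGenusTwoSextic (d8Form (9 / 100 : k))) := ⟨ht⟩
  -- The matrix with rows (ν, 3), (10, ν) has squared trace and determinant both equal to −40, so
  -- its cube is scalar; e² = (−40)³.
  obtain ⟨ν, hν⟩ := IsAlgClosed.exists_pow_nat_eq (-10 : k) two_pos
  obtain ⟨e, he⟩ := IsAlgClosed.exists_pow_nat_eq (-64000 : k) two_pos
  have he0 : e ≠ 0 := by
    rintro rfl
    norm_num at he
  have hdet : ν * ν - 3 * 10 ≠ 0 := by
    rw [← sq, hν]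
    norm_num
  have hmob : moebius 6 ν 3 10 ν (d8Form (9 / 100)) = C (e ^ 2) * d8Form (9 / 100) := by
    rw [he]
    have hN : (C ν : k[X]) ^ 2 = -10 := by
      rw [← map_pow, hν, map_neg, map_ofNat]
    have hQ : (C (9 / 100) : k[X]) * 100 = 9 := by
      rw [← map_ofNat C 100, ← map_mul, ← map_ofNat C 9]
      congr 1
      norm_num
    have h3 : (C 3 : k[X]) = 3 := map_ofNat C 3
    have h10 : (C 10 : k[X]) = 10 := map_ofNat C 10
    have hE : (C (-64000) : k[X]) = -64000 := by rw [map_neg, map_ofNat]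
    simp only [moebius, Finset.sum_range_succ, Finset.sum_range_zero, d8Form, coeff_add,
      coeff_C_mul, coeff_X_pow, coeff_X, h3, h10, hE]
    norm_num
    generalize C (9 / 100 : k) = Q at hQ ⊢
    generalize C ν = N at hN ⊢
    grind
  obtain ⟨τ, hτ⟩ := exists_algEquiv_isGivenBy (f := d8Form (9 / 100)) (g := d8Form (9 / 100))
    hdet he0 hmob
  have h2 := hτ.mul hτ
  have h3 := hτ.mul h2
  have hne : τ (xGen (d8Form (9 / 100))) ≠ xGen (d8Form (9 / 100)) := by
    rw [Ne, hτ.map_xGen_eq_self_iff]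
    norm_num
  have hfix : (τ * τ * τ) (xGen (d8Form (9 / 100))) = xGen (d8Form (9 / 100)) := by
    rw [h3.map_xGen_eq_self_iff]
    refine ⟨?_, ?_, ?_⟩
    · linear_combination 9 * hν
    · linear_combination 30 * hν
    · ring
  have h6 : (τ * τ * τ) * (τ * τ * τ) = 1 := by
    rcases eq_one_or_hyperelliptic hfix with h | h
    · rw [h, one_mul]
    · rw [h, hyperelliptic_mul_self]
  have h4 := pow_four_eq_one φ τ
  have hττ : τ * τ = 1 := by
    calc τ * τ = τ ^ 4 * (τ * τ) := by rw [h4, one_mul]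
      _ = τ * τ * τ * (τ * τ * τ) := by
        simp only [pow_succ, pow_zero, one_mul, mul_assoc]
      _ = 1 := h6
  rw [hττ, one_mul] at hfix
  exact hne hfix

theorem exists_curveIso_d8Form_of_dihedral_four [IsAlgClosed k] {f : k[X]}
    (hf : IsGenusTwoSextic f) (hφ : Nonempty (CurveAut f ≃* DihedralGroup 4)) :
    ∃ t, t ≠ 9 / 100 ∧ IsGenusTwoSextic (d8Form t) ∧ CurveIso f (d8Form t) := by
  have : Fact (IsGenusTwoSextic f) := ⟨hf⟩
  obtain ⟨φ⟩ := hφ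
  obtain ⟨σ, hσ⟩ := exists_sq_eq_hyperelliptic φ
  obtain ⟨α, β, γ, hα, hg, hfg⟩ := exists_odd_quintic hσ
  have hβ := cubic_coeff_ne_zero_of_dihedral_four hg (hfg.aut_mulEquiv ⟨φ⟩)
  obtain ⟨t, ht, hgt⟩ := exists_curveIso_d8Form hα hβ hg
  have hft := hfg.trans hgt
  exact ⟨t, d8Form_param_ne ht (hft.aut_mulEquiv ⟨φ⟩), ht, hft⟩

end NormalForms

/-! ### The D₁₂ normal form -/

section NormalForms

variable {k : Type*} [Field k]

theorem exists_curveIso_d12Form [IsAlgClosed k] {α β γ : k} (hα : α ≠ 0) (hβ : β ≠ 0)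
    (hg : IsGenusTwoSextic (C α * X ^ 6 + C β * X ^ 3 + C γ)) :
    ∃ t, IsGenusTwoSextic (d12Form t) ∧
      CurveIso (C α * X ^ 6 + C β * X ^ 3 + C γ) (d12Form t) := by
  obtain ⟨p, hp⟩ := IsAlgClosed.exists_pow_nat_eq (β / α) three_pos
  have hp0 : p ≠ 0 := by
    rintro rfl
    refine div_ne_zero hβ hα ?_
    rw [← hp]
    ring
  have hβp : β = α * p ^ 3 := by
    rw [hp]
    field_simp
  obtain ⟨e, he⟩ := IsAlgClosed.exists_pow_nat_eq (α * p ^ 6) two_pos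
  have hE : α * p ^ 6 ≠ 0 := mul_ne_zero hα (pow_ne_zero 6 hp0)
  have he0 : e ≠ 0 := by
    rintro rfl
    refine hE ?_
    rw [← he]
    ring
  have hmob : moebius 6 p 0 0 1 (C α * X ^ 6 + C β * X ^ 3 + C γ) =
      C (e ^ 2) * d12Form (γ / (α * p ^ 6)) := by
    rw [he]
    apply eq_of_coeff_eq_of_natDegree_le_six (natDegree_moebius_le _ _ _ _ _ _)
    · refine (natDegree_C_mul_le _ _).trans ?_
      rw [d12Form]
      compute_degree
    all_goals
      rw [coeff_moebius_diagonal _ _ _ (by norm_num), coeff_C_mul]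
      simp [coeff_C, coeff_X_pow, d12Form]
    · field_simp
    · rw [hβp]
      ring
  have hdet : p * 1 - 0 * 0 ≠ 0 := by simpa using hp0
  have ht : IsGenusTwoSextic (d12Form (γ / (α * p ^ 6))) := by
    have h1 := (hg.moebius hdet).C_mul (inv_ne_zero (pow_ne_zero 2 he0))
    rwa [hmob, ← mul_assoc, ← map_mul, inv_mul_cancel₀ (pow_ne_zero 2 he0), map_one, one_mul]
      at h1
  exact ⟨_, ht, curveIso_of_moebius hg ht hdet he0 hmob⟩

variable [CharZero k]

/-- The cube of the matrix M is (tr² − det)M minus a scalar, so tr² = det and the eigenvalue ratio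
is a primitive cube root of unity. Surviving exponents are congruent mod 3; the class of 5 leaves
only X⁵ and X², divisible by X², so the exponents are 0, 3, 6. -/
theorem exists_cubic_in_X_cube [IsAlgClosed k] {f : k[X]} [hf : Fact (IsGenusTwoSextic f)]
    {σ : CurveAut f} (hσ : σ * σ * σ = 1) (hσ1 : σ ≠ 1) :
    ∃ α β γ : k, α ≠ 0 ∧ IsGenusTwoSextic (C α * X ^ 6 + C β * X ^ 3 + C γ) ∧
      CurveIso f (C α * X ^ 6 + C β * X ^ 3 + C γ) := by
  obtain ⟨a, b, c, d, e, h⟩ := exists_isGivenBy σ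
  have h3 := h.mul (h.mul h)
  rw [hσ] at h3
  obtain ⟨hb, hc, had⟩ := h3.map_xGen_eq_self_iff.1 rfl
  have hdet := h.det_ne_zero
  have hq : (a + d) ^ 2 - (a * d - b * c) = 0 := by
    by_contra hq
    have hb0 : b = 0 := (mul_eq_zero.1 (show b * ((a + d) ^ 2 - (a * d - b * c)) = 0 by
      linear_combination hb)).resolve_right hq
    have hc0 : c = 0 := (mul_eq_zero.1 (show c * ((a + d) ^ 2 - (a * d - b * c)) = 0 by
      linear_combination hc)).resolve_right hq
    have had0 : a = d := by
      have : (a - d) * ((a + d) ^ 2 - (a * d - b * c)) = 0 := by linear_combination had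
      exact sub_eq_zero.1 ((mul_eq_zero.1 this).resolve_right hq)
    rcases eq_one_or_hyperelliptic (h.map_xGen_eq_self_iff.2 ⟨hb0, hc0, had0⟩) with h1 | h1
    · exact hσ1 h1
    · rw [h1, hyperelliptic_mul_self, one_mul] at hσ
      exact hyperelliptic_ne_one f hσ
  have hdisc : (a + d) ^ 2 - 4 * (a * d - b * c) ≠ 0 := by
    rw [show (a + d) ^ 2 - 4 * (a * d - b * c) = -3 * (a * d - b * c) by linear_combination hq]
    exact mul_ne_zero (by norm_num) hdet
  obtain ⟨l, m, g, hlm, hadd, hmul, hg, hfg, hcoef⟩ :=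
    exists_diagonal_form hf.out hdet hdisc h.moebius_eq
  have hlm0 : l * m ≠ 0 := hmul ▸ hdet
  have hl : l ≠ 0 := left_ne_zero_of_mul hlm0
  have hm : m ≠ 0 := right_ne_zero_of_mul hlm0
  have hsub : l - m ≠ 0 := sub_ne_zero.2 hlm
  have hquad : l ^ 2 + l * m + m ^ 2 = 0 := by
    rw [← hadd, ← hmul] at hq
    linear_combination hq
  have hcube : l ^ 3 = m ^ 3 := by linear_combination (l - m) * hquad
  have hsum : l + m ≠ 0 := by
    intro h0
    apply hlm0
    linear_combination (l + m) * h0 - hquad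
  have hzero : ∀ {x ε w : k}, x * w = ε * x → w - ε ≠ 0 → x = 0 := by
    intro x ε w h1 h2
    exact (mul_eq_zero.1 (show x * (w - ε) = 0 by linear_combination h1)).resolve_right h2
  have hε : ∀ {i : ℕ}, i ≤ 6 → g.coeff i ≠ 0 → e ^ 2 = l ^ i * m ^ (6 - i) := by
    intro i hi hne
    apply mul_right_cancel₀ hne
    linear_combination -hcoef i hi
  have c6 : g.coeff 6 ≠ 0 := by
    intro c6
    have c5 : g.coeff 5 ≠ 0 := by
      intro c5
      have h5 := hg.five_le
      have h6 := hg.1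
      have hne := leadingCoeff_ne_zero.2 hg.ne_zero
      rw [leadingCoeff] at hne
      rcases h6 with h6 | h6 <;> rw [h6] at hne
      · exact hne c5
      · exact hne c6
    have hE := hε (i := 5) (by norm_num) c5
    norm_num at hE
    have c0 : g.coeff 0 = 0 := by
      refine hzero (hcoef 0 (by norm_num)) ?_
      rw [hE]
      have : l ^ 0 * m ^ (6 - 0) - l ^ 5 * m = m ^ 3 * l ^ 2 * (l - m) := by
        norm_num
        linear_combination (-m ^ 3 - l ^ 2 * m) * hcube
      rw [this]
      exact mul_ne_zero (mul_ne_zero (pow_ne_zero 3 hm) (pow_ne_zero 2 hl)) hsub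
    have c1 : g.coeff 1 = 0 := by
      refine hzero (hcoef 1 (by norm_num)) ?_
      rw [hE]
      have : l ^ 1 * m ^ (6 - 1) - l ^ 5 * m = l * m * m ^ 3 * (m - l) := by
        norm_num
        linear_combination (-l ^ 2 * m) * hcube
      rw [this]
      exact mul_ne_zero (mul_ne_zero hlm0 (pow_ne_zero 3 hm)) (sub_ne_zero.2 hlm.symm)
    exact not_isGenusTwoSextic_of_X_sq_dvd (X_pow_dvd_iff.2 fun i hi => by
      interval_cases i <;> assumption) hg
  have hE := hε (i := 6) le_rfl c6
  norm_num at hE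
  have c1 : g.coeff 1 = 0 := by
    refine hzero (hcoef 1 (by norm_num)) ?_
    rw [hE, show l ^ 1 * m ^ (6 - 1) - l ^ 6 = l * m ^ 3 * ((m - l) * (m + l)) by
      norm_num
      linear_combination (-l ^ 3) * hcube]
    exact mul_ne_zero (mul_ne_zero hl (pow_ne_zero 3 hm))
      (mul_ne_zero (sub_ne_zero.2 hlm.symm) (by rwa [add_comm]))
  have c2 : g.coeff 2 = 0 := by
    refine hzero (hcoef 2 (by norm_num)) ?_
    rw [hE, show l ^ 2 * m ^ (6 - 2) - l ^ 6 = l ^ 2 * m ^ 3 * (m - l) by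
      norm_num
      linear_combination (-l ^ 3) * hcube]
    exact mul_ne_zero (mul_ne_zero (pow_ne_zero 2 hl) (pow_ne_zero 3 hm)) (sub_ne_zero.2 hlm.symm)
  have c4 : g.coeff 4 = 0 := by
    refine hzero (hcoef 4 (by norm_num)) ?_
    rw [hE, show l ^ 4 * m ^ (6 - 4) - l ^ 6 = l ^ 4 * ((m - l) * (m + l)) by
      norm_num
      ring]
    exact mul_ne_zero (pow_ne_zero 4 hl)
      (mul_ne_zero (sub_ne_zero.2 hlm.symm) (by rwa [add_comm]))
  have c5 : g.coeff 5 = 0 := by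
    refine hzero (hcoef 5 (by norm_num)) ?_
    rw [hE, show l ^ 5 * m ^ (6 - 5) - l ^ 6 = l ^ 5 * (m - l) by
      norm_num
      ring]
    exact mul_ne_zero (pow_ne_zero 5 hl) (sub_ne_zero.2 hlm.symm)
  have hgeq : g = C (g.coeff 6) * X ^ 6 + C (g.coeff 3) * X ^ 3 + C (g.coeff 0) := by
    apply eq_of_coeff_eq_of_natDegree_le_six hg.le_six
    · compute_degree
    all_goals simp [coeff_X_pow, coeff_C, c1, c2, c4, c5]
  exact ⟨g.coeff 6, g.coeff 3, g.coeff 0, c6, hgeq ▸ hg, hgeq ▸ hfg⟩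

/-- If β = 0, then X ↦ ζX with ζ a primitive sixth root of unity has order 6 modulo the
hyperelliptic involution, while D₁₂ modulo its center has no element of order 6. -/
theorem cubic_coeff_ne_zero_of_dihedral_six [IsAlgClosed k] {α β γ : k}
    (hg : IsGenusTwoSextic (C α * X ^ 6 + C β * X ^ 3 + C γ))
    (hφ : Nonempty (CurveAut (C α * X ^ 6 + C β * X ^ 3 + C γ) ≃* DihedralGroup 6)) :
    β ≠ 0 := by
  rintro rfl
  obtain ⟨φ⟩ := hφ
  generalize hgeq : (C α * X ^ 6 + C 0 * X ^ 3 + C γ : k[X]) = g at hg φ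
  have : Fact (IsGenusTwoSextic g) := ⟨hg⟩
  obtain ⟨s, hs⟩ := IsAlgClosed.exists_pow_nat_eq (-3 : k) two_pos
  obtain ⟨ζ, hζs⟩ : ∃ ζ : k, ζ = (1 + s) / 2 := ⟨_, rfl⟩
  have hζ : ζ ^ 2 = ζ - 1 := by
    rw [hζs]
    linear_combination hs / 4
  have hζ3 : ζ ^ 3 = -1 := by linear_combination (ζ + 1) * hζ
  have hζ0 : ζ ≠ 0 := by
    rintro rfl
    norm_num at hζ3
  have hmob : moebius 6 ζ 0 0 1 g = C (1 ^ 2) * g := by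
    rw [one_pow, map_one, one_mul]
    apply eq_of_coeff_eq_of_natDegree_le_six (natDegree_moebius_le _ _ _ _ _ _) hg.le_six
    all_goals
      rw [coeff_moebius_diagonal _ _ _ (by norm_num), ← hgeq]
      simp [coeff_X_pow, coeff_C]
    · linear_combination α * (ζ ^ 3 - 1) * hζ3
  obtain ⟨τ, hτ⟩ := exists_algEquiv_isGivenBy (f := g) (g := g) (by simpa using hζ0) one_ne_zero
    hmob
  have h2 := hτ.mul hτ
  have h3 := hτ.mul h2
  have h3fix : (τ * τ * τ) (xGen g) ≠ xGen g := by
    rw [Ne, h3.map_xGen_eq_self_iff]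
    rintro ⟨-, -, h⟩
    have h6 : (2 : k) = 0 := by linear_combination hζ3 - h
    exact two_ne_zero h6
  rcases sq_or_cube_of_dihedral_six φ τ with h | h | h
  · rw [h] at h2
    obtain ⟨-, -, h⟩ := h2.map_xGen_eq_self_iff.1 rfl
    have h6 : (3 : k) = 0 := by
      have h7 : ζ = 2 := by linear_combination h - hζ
      rw [h7] at h
      linear_combination h
    exact three_ne_zero h6
  · exact h3fix (by rw [h, AlgEquiv.one_apply])
  · exact h3fix (by rw [h, hyperelliptic_xGen])

/-- At t = −1/50 the hyperelliptic involution is a square, but in D₁₂ the central involution is not.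
-/
theorem d12Form_param_ne [IsAlgClosed k] {t : k} (ht : IsGenusTwoSextic (d12Form t))
    (hφ : Nonempty (CurveAut (d12Form t) ≃* DihedralGroup 6)) : t ≠ -1 / 50 := by
  rintro rfl
  obtain ⟨φ⟩ := hφ
  have : Fact (IsGenusTwoSextic (d12Form (-1 / 50 : k))) := ⟨ht⟩
  -- The trace-zero matrix with rows (−p, 2), (p², p) has square 3p²; the scale e² = −(3p²)³ =
  -- −10800 has the sign that makes τ² hyperelliptic.
  obtain ⟨p, hp⟩ := IsAlgClosed.exists_pow_nat_eq (20 : k) three_pos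
  obtain ⟨e, he⟩ := IsAlgClosed.exists_pow_nat_eq (-10800 : k) two_pos
  have hp0 : p ≠ 0 := by
    rintro rfl
    norm_num at hp
  have he0 : e ≠ 0 := by
    rintro rfl
    norm_num at he
  have hdet : -p * p - 2 * p ^ 2 ≠ 0 := by
    rw [show -p * p - 2 * p ^ 2 = -3 * p ^ 2 by ring]
    exact mul_ne_zero (by norm_num) (pow_ne_zero 2 hp0)
  have hmob : moebius 6 (-p) 2 (p ^ 2) p (d12Form (-1 / 50)) = C (e ^ 2) * d12Form (-1 / 50) := by
    rw [he]
    have hP : (C p : k[X]) ^ 3 = 20 := by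
      rw [← map_pow, hp, map_ofNat]
    have hQ : (C (-1 / 50) : k[X]) * 50 = -1 := by
      rw [← map_ofNat C 50, ← map_mul, ← map_one C, ← map_neg]
      congr 1
      norm_num
    have h2 : (C 2 : k[X]) = 2 := map_ofNat C 2
    have hE : (C (-10800) : k[X]) = -10800 := by rw [map_neg, map_ofNat]
    simp only [moebius, Finset.sum_range_succ, Finset.sum_range_zero, d12Form, coeff_add,
      coeff_X_pow, coeff_C, h2, hE, map_neg C p, map_pow]
    generalize hQ' : C (-1 / 50 : k) = Q at hQ ⊢
    norm_num
    rw [show (C (1 / 50) : k[X]) = -Q by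
      rw [← hQ', ← map_neg]
      congr 1
      norm_num]
    generalize C p = P at hP ⊢
    grind
  obtain ⟨τ, hτ⟩ := exists_algEquiv_isGivenBy (f := d12Form (-1 / 50)) (g := d12Form (-1 / 50))
    hdet he0 hmob
  have h2 := hτ.mul hτ
  have hfix : (τ * τ) (xGen (d12Form (-1 / 50))) = xGen (d12Form (-1 / 50)) := by
    rw [h2.map_xGen_eq_self_iff]
    refine ⟨?_, ?_, ?_⟩ <;> ring
  rcases eq_one_or_hyperelliptic hfix with h | h
  · rw [h] at h2
    have h3 := h2.scale_eq_of_one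
    have h4 : (21600 : k) = 0 := by
      linear_combination h3 + he - 27 * (p ^ 3 + 20) * hp
    norm_num at h4
  · exact mul_self_ne_hyperelliptic φ τ h

theorem exists_curveIso_d12Form_of_dihedral_six [IsAlgClosed k] {f : k[X]}
    (hf : IsGenusTwoSextic f) (hφ : Nonempty (CurveAut f ≃* DihedralGroup 6)) :
    ∃ t, t ≠ -1 / 50 ∧ IsGenusTwoSextic (d12Form t) ∧ CurveIso f (d12Form t) := by
  have : Fact (IsGenusTwoSextic f) := ⟨hf⟩
  obtain ⟨φ⟩ := hφ
  obtain ⟨σ, hσ, hσ1⟩ := exists_order_three φ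
  obtain ⟨α, β, γ, hα, hg, hfg⟩ := exists_cubic_in_X_cube hσ hσ1
  have hβ := cubic_coeff_ne_zero_of_dihedral_six hg (hfg.aut_mulEquiv ⟨φ⟩)
  obtain ⟨t, ht, hgt⟩ := exists_curveIso_d12Form hα hβ hg
  have hft := hfg.trans hgt
  exact ⟨t, d12Form_param_ne ht (hft.aut_mulEquiv ⟨φ⟩), ht, hft⟩

end NormalForms

/-! ### Recovering t from i₁ and i₂; descent to ℚ -/

section Parameters

variable {k : Type*} [Field k]

theorem J2_d8Form (t : k) : J2 (d8Form t) = 40 * t + 6 := by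
  simp [J2, d8Form, coeff_X_pow, coeff_X]

theorem J4_d8Form (t : k) : J4 (d8Form t) = 36 * t - 80 * t ^ 2 := by
  simp [J4, d8Form, coeff_X_pow, coeff_X]
  ring

theorem J6_d8Form (t : k) : J6 (d8Form t) = 72 * t + 176 * t ^ 2 - 320 * t ^ 3 := by
  simp [J6, d8Form, coeff_X_pow, coeff_X]
  ring

theorem J2_d12Form (t : k) : J2 (d12Form t) = 6 - 240 * t := by
  simp [J2, d12Form, coeff_X_pow, coeff_C]
  ring

theorem J4_d12Form (t : k) : J4 (d12Form t) = 324 * t + 1620 * t ^ 2 := by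
  simp [J4, d12Form, coeff_X_pow, coeff_C]
  ring

theorem J6_d12Form (t : k) :
    J6 (d12Form t) = 162 * t - 10044 * t ^ 2 - 119880 * t ^ 3 := by
  simp [J6, d12Form, coeff_X_pow, coeff_C]
  ring

theorem d8Den_d8Form [CharZero k] {t : k} (hJ : J2 (d8Form t) ≠ 0) :
    d8Den (i1 (d8Form t)) (i2 (d8Form t)) =
      134369280000 * (t - 9 / 100) ^ 2 / J2 (d8Form t) ^ 5 := by
  -- With j = J₂ as the variable, the denominators are powers of an atom.
  obtain ⟨j, rfl⟩ : ∃ j, t = (j - 6) / 40 := ⟨40 * t + 6, by ring⟩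
  have hj : 40 * ((j - 6) / 40) + 6 = j := by ring
  rw [J2_d8Form, hj] at hJ
  rw [d8Den, i1, i2, J2_d8Form, J4_d8Form, J6_d8Form, hj]
  field_simp
  ring

/-- The numerator has no constant term in i₁, i₂, so the identity persists at J₂ = 0, where division
by zero makes both sides 0. -/
theorem d8Num_d8Form [CharZero k] {t : k} :
    d8Num (i1 (d8Form t)) (i2 (d8Form t)) =
      -179159040000 * t * (t - 9 / 100) ^ 2 / J2 (d8Form t) ^ 5 := by
  rw [d8Num, i1, i2, J2_d8Form, J4_d8Form, J6_d8Form]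
  field_simp
  ring

theorem d12Den_d12Form [CharZero k] {t : k} (hJ : J2 (d12Form t) ≠ 0) :
    d12Den (i1 (d12Form t)) (i2 (d12Form t)) =
      -13774950720000 * (t + 1 / 50) ^ 2 / J2 (d12Form t) ^ 5 := by
  obtain ⟨j, rfl⟩ : ∃ j, t = (6 - j) / 240 := ⟨6 - 240 * t, by ring⟩
  have hj : 6 - 240 * ((6 - j) / 240) = j := by ring
  rw [J2_d12Form, hj] at hJ
  rw [d12Den, i1, i2, J2_d12Form, J4_d12Form, J6_d12Form, hj]
  field_simp
  ring

theorem d12Num_d12Form [CharZero k] {t : k} :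
    d12Num (i1 (d12Form t)) (i2 (d12Form t)) =
      -55099802880000 * t * (t + 1 / 50) ^ 2 / J2 (d12Form t) ^ 5 := by
  rw [d12Num, i1, i2, J2_d12Form, J4_d12Form, J6_d12Form]
  field_simp
  ring

theorem d8Den_ne_zero_and_d8Param_eq [CharZero k] {t : k} (hJ : J2 (d8Form t) ≠ 0)
    (ht : t ≠ 9 / 100) :
    d8Den (i1 (d8Form t)) (i2 (d8Form t)) ≠ 0 ∧
      d8Param (i1 (d8Form t)) (i2 (d8Form t)) = t := by
  have h1 : t - 9 / 100 ≠ 0 := sub_ne_zero.2 ht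
  rw [d8Param, d8Den_d8Form hJ, d8Num_d8Form]
  refine ⟨div_ne_zero (mul_ne_zero (by norm_num) (pow_ne_zero 2 h1)) (pow_ne_zero 5 hJ), ?_⟩
  generalize t - 9 / 100 = s at h1
  field_simp
  ring

theorem d12Den_ne_zero_and_d12Param_eq [CharZero k] {t : k} (hJ : J2 (d12Form t) ≠ 0)
    (ht : t ≠ -1 / 50) :
    d12Den (i1 (d12Form t)) (i2 (d12Form t)) ≠ 0 ∧
      d12Param (i1 (d12Form t)) (i2 (d12Form t)) = t := by
  have h1 : t + 1 / 50 ≠ 0 := by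
    intro h
    apply ht
    linear_combination h
  rw [d12Param, d12Den_d12Form hJ, d12Num_d12Form]
  refine ⟨div_ne_zero (mul_ne_zero (by norm_num) (pow_ne_zero 2 h1)) (pow_ne_zero 5 hJ), ?_⟩
  generalize t + 1 / 50 = s at h1
  field_simp
  ring

theorem IsGenusTwoSextic.of_map {F : Type*} [Field F] [Algebra F k] {g : F[X]}
    (h : IsGenusTwoSextic (g.map (algebraMap F k))) : IsGenusTwoSextic g := by
  refine ⟨by simpa using h.1, fun x hx => ?_⟩
  have h1 := h.2 (x.map (algebraMap F k)) (by
    rw [← Polynomial.map_mul]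
    exact Polynomial.map_dvd _ hx)
  rwa [isUnit_map] at h1

theorem hasRationalModel_of_map [CharZero k] {f f' : k[X]} {g : ℚ[X]}
    (hg : g.map (algebraMap ℚ k) = f') (hf' : IsGenusTwoSextic f') (h : CurveIso f f') :
    HasRationalModel f := by
  subst hg
  exact ⟨g, hf'.of_map, h⟩

theorem map_d8Form (q : ℚ) [CharZero k] :
    (d8Form q).map (algebraMap ℚ k) = d8Form (q : k) := by
  simp [d8Form]

theorem map_d12Form (q : ℚ) [CharZero k] :
    (d12Form q).map (algebraMap ℚ k) = d12Form (q : k) := by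
  simp [d12Form]

theorem d8Param_ratCast [CharZero k] (q₁ q₂ : ℚ) :
    d8Param (q₁ : k) (q₂ : k) = ((d8Param q₁ q₂ : ℚ) : k) := by
  simp [d8Param, d8Num, d8Den]

theorem d12Param_ratCast [CharZero k] (q₁ q₂ : ℚ) :
    d12Param (q₁ : k) (q₂ : k) = ((d12Param q₁ q₂ : ℚ) : k) := by
  simp [d12Param, d12Num, d12Den]

end Parameters

end GenusTwo

end

/-! ### The main theorem -/

theorem lemma4 {k : Type*} [Field k] [IsAlgClosed k] [CharZero k]
    (f : k[X]) (hf : GenusTwo.IsGenusTwoSextic f) (hJ : GenusTwo.J2 f ≠ 0) :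
    -- a point of the locus of curves with automorphism group dihedral of order `8`
    (Nonempty (GenusTwo.CurveAut f ≃* DihedralGroup 4) →
      GenusTwo.d8Den (GenusTwo.i1 f) (GenusTwo.i2 f) ≠ 0 ∧
      GenusTwo.IsGenusTwoSextic
        (GenusTwo.d8Form (GenusTwo.d8Param (GenusTwo.i1 f) (GenusTwo.i2 f))) ∧
      GenusTwo.CurveIso f
        (GenusTwo.d8Form (GenusTwo.d8Param (GenusTwo.i1 f) (GenusTwo.i2 f))) ∧
      (∀ t : k, GenusTwo.IsGenusTwoSextic (GenusTwo.d8Form t) →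
        GenusTwo.CurveIso f (GenusTwo.d8Form t) →
        t = GenusTwo.d8Param (GenusTwo.i1 f) (GenusTwo.i2 f)) ∧
      ((∃ q₁ q₂ : ℚ, GenusTwo.i1 f = (q₁ : k) ∧ GenusTwo.i2 f = (q₂ : k)) →
        GenusTwo.HasRationalModel f)) ∧
    -- a point of the locus of curves with automorphism group dihedral of order `12`
    (Nonempty (GenusTwo.CurveAut f ≃* DihedralGroup 6) →
      GenusTwo.d12Den (GenusTwo.i1 f) (GenusTwo.i2 f) ≠ 0 ∧
      GenusTwo.IsGenusTwoSextic
        (GenusTwo.d12Form (GenusTwo.d12Param (GenusTwo.i1 f) (GenusTwo.i2 f))) ∧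
      GenusTwo.CurveIso f
        (GenusTwo.d12Form (GenusTwo.d12Param (GenusTwo.i1 f) (GenusTwo.i2 f))) ∧
      (∀ t : k, GenusTwo.IsGenusTwoSextic (GenusTwo.d12Form t) →
        GenusTwo.CurveIso f (GenusTwo.d12Form t) →
        t = GenusTwo.d12Param (GenusTwo.i1 f) (GenusTwo.i2 f)) ∧
      ((∃ q₁ q₂ : ℚ, GenusTwo.i1 f = (q₁ : k) ∧ GenusTwo.i2 f = (q₂ : k)) →
        GenusTwo.HasRationalModel f)) := by
  refine ⟨?_, ?_⟩
  · intro hφ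
    obtain ⟨t, ht, hgt, hft⟩ := GenusTwo.exists_curveIso_d8Form_of_dihedral_four hf hφ
    obtain ⟨hJt, h1, h2⟩ := GenusTwo.invariants_eq_of_curveIso hf hgt hJ hft
    obtain ⟨hden, hpar⟩ := GenusTwo.d8Den_ne_zero_and_d8Param_eq hJt ht
    rw [h1, h2] at hden hpar
    rw [hpar]
    refine ⟨hden, hgt, hft, fun t' ht' hft' => ?_, ?_⟩
    · obtain ⟨hJt', h1', h2'⟩ := GenusTwo.invariants_eq_of_curveIso hf ht' hJ hft'
      -- The denominator depends only on i₁, i₂ and is already nonzero, whereas it vanishes at the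
      -- exceptional parameter.
      have hne : t' ≠ 9 / 100 := by
        rintro rfl
        have h3 := GenusTwo.d8Den_d8Form hJt'
        rw [h1', h2'] at h3
        apply hden
        rw [h3]
        ring
      have hpar' := (GenusTwo.d8Den_ne_zero_and_d8Param_eq hJt' hne).2
      rw [h1', h2', hpar] at hpar'
      exact hpar'.symm
    · rintro ⟨q₁, q₂, hq₁, hq₂⟩
      rw [hq₁, hq₂, GenusTwo.d8Param_ratCast] at hpar
      exact GenusTwo.hasRationalModel_of_map
        ((GenusTwo.map_d8Form (GenusTwo.d8Param q₁ q₂)).trans (by rw [hpar])) hgt hft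
  · intro hφ
    obtain ⟨t, ht, hgt, hft⟩ := GenusTwo.exists_curveIso_d12Form_of_dihedral_six hf hφ
    obtain ⟨hJt, h1, h2⟩ := GenusTwo.invariants_eq_of_curveIso hf hgt hJ hft
    obtain ⟨hden, hpar⟩ := GenusTwo.d12Den_ne_zero_and_d12Param_eq hJt ht
    rw [h1, h2] at hden hpar
    rw [hpar]
    refine ⟨hden, hgt, hft, fun t' ht' hft' => ?_, ?_⟩
    · obtain ⟨hJt', h1', h2'⟩ := GenusTwo.invariants_eq_of_curveIso hf ht' hJ hft'
      have hne : t' ≠ -1 / 50 := by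
        rintro rfl
        have h3 := GenusTwo.d12Den_d12Form hJt'
        rw [h1', h2'] at h3
        apply hden
        rw [h3]
        ring
      have hpar' := (GenusTwo.d12Den_ne_zero_and_d12Param_eq hJt' hne).2
      rw [h1', h2', hpar] at hpar'
      exact hpar'.symm
    · rintro ⟨q₁, q₂, hq₁, hq₂⟩
      rw [hq₁, hq₂, GenusTwo.d12Param_ratCast] at hpar
      exact GenusTwo.hasRationalModel_of_map
        ((GenusTwo.map_d12Form (GenusTwo.d12Param q₁ q₂)).trans (by rw [hpar])) hgt hft
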